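/- **Corollary (Harvey–Lawson cones are rigid).** Equip $\mathbb{C}^m$ with the Euclidean metric, the symplectic form $\omega=\sum_j dx_j\wedge dy_j$ and the holomorphic volume form $\Omega=dz_1\wedge\cdots\wedge dz_m$. A special Lagrangian cone (with smooth, connected link) is a closed cone $\mathbf{C}\subset\mathbb{C}^m$ with connected link $\mathbf{C}\cap S^{2m-1}$ such that $\mathbf{C}\setminus\{0\}$ is a smooth embedded $m$-dimensional submanifold on which $\omega$ and $\operatorname{Im}\Omega$ vanish. A real function $u$ on $\mathbf{C}\setminus\{0\}$ is harmonic if it is $C^2$ and annihilated by the Laplace–Beltrami operator of the induced metric; it has linear (respectively quadratic) growth if there is a constant $K$ with $|u(z)|\le K|z|$ (respectively $|u(z)|\le K|z|^2$) for all $z\in\mathbf{C}\setminus\{0\}$. The cone $\mathbf{C}$ is called rigid if (i) every harmonic function $u$ of linear growth on $\mathbf{C}\setminus\{0\}$ is generated by a translation: there is $v\in\mathbb{C}^m$ with $u(z)=\omega(v,z)$ for all $z\in\mathbf{C}\setminus\{0\}$; and (ii) every harmonic function $u$ of quadratic growth on $\mathbf{C}\setminus\{0\}$ is generated by an element of $\mathfrak{su}(m)$: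 there is a trace-free skew-Hermitian matrix $A$ with $u(z)=\tfrac12\,\omega(Az,z)$ for all $z\in\mathbf{C}\setminus\{0\}$. (The functions $\omega(v,z)$ and $\tfrac12\omega(Az,z)$ are the Hamiltonians, vanishing at $0$, of the vector fields $v$ and $Az$, i.e. the components of the moment map of $\mathfrak{su}(m)\oplus\mathbb{C}^m$.) Let $m\ge 1$ be an integer with $m\neq 8,9$. Then the Harvey–Lawson cone $$\mathbf{C}^m_{HL}=\{(z_1,\dots,z_m)\in\mathbb{C}^m : |z_1|=\cdots=|z_m|,\ \operatorname{Arg}(i^{m+1}z_1\cdots z_m)=0\}$$ (with the vertex $0$ included) is a special Lagrangian cone with smooth, connected link, and it is rigid. -/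

import Mathlib

open scoped ContDiff

noncomputable section

namespace HLRigid

/-- `ℂᵐ` with its standard Hermitian structure. -/
abbrev Cn (m : ℕ) : Type := EuclideanSpace ℂ (Fin m)

/-- The Euclidean (real) inner product `Re ∑ conj(aⱼ) bⱼ = ∑ (xⱼ(a) xⱼ(b) + yⱼ(a) yⱼ(b))`. -/
def euclid {m : ℕ} (a b : Cn m) : ℝ := (inner ℂ a b).re

/-- The standard symplectic form `ω = ∑ dxⱼ ∧ dyⱼ`, that is
`ω(a, b) = ∑ (xⱼ(a) yⱼ(b) - yⱼ(a) xⱼ(b)) = Im ∑ conj(aⱼ) bⱼ`. -/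
def omega {m : ℕ} (a b : Cn m) : ℝ := (inner ℂ a b).im

/-- The holomorphic volume form `Ω = dz₁ ∧ ⋯ ∧ dzₘ`. -/
def Omega {m : ℕ} (w : Fin m → Cn m) : ℂ := Matrix.det (Matrix.of fun a j => w a j)

/-- The coordinate partial derivative `∂f/∂tᵢ` on `ℝⁿ`. -/
def partialD {n : ℕ} {F : Type*} [NormedAddCommGroup F] [NormedSpace ℝ F]
    (i : Fin n) (f : EuclideanSpace ℝ (Fin n) → F) (x : EuclideanSpace ℝ (Fin n)) : F :=
  fderiv ℝ f x (EuclideanSpace.single i 1)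

/-- `φ : U → M` is a smooth local parametrization of the subset `M` of `ℂᵐ` by an open subset `U`
of `ℝⁿ`: a smooth immersion which is a homeomorphism onto a relatively open subset of `M`. -/
structure IsLocalParam {m n : ℕ} (M : Set (Cn m)) (U : Set (EuclideanSpace ℝ (Fin n)))
    (φ : EuclideanSpace ℝ (Fin n) → Cn m) : Prop where
  isOpen : IsOpen U
  smooth : ContDiffOn ℝ ∞ φ U
  immersion : ∀ x ∈ U, Function.Injective (fderiv ℝ φ x)
  embedding : Topology.IsEmbedding (U.domRestrict φ)
  image_open : ∃ W : Set (Cn m), IsOpen W ∧ φ '' U = M ∩ W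

/-- The metric `gᵢⱼ = ⟨∂ᵢφ, ∂ⱼφ⟩` induced by the Euclidean metric, in a parametrization `φ`. -/
def inducedMetric {m n : ℕ} (φ : EuclideanSpace ℝ (Fin n) → Cn m)
    (x : EuclideanSpace ℝ (Fin n)) : Matrix (Fin n) (Fin n) ℝ :=
  Matrix.of fun i j => euclid (partialD i φ x) (partialD j φ x)

/-- The Laplace-Beltrami operator of the induced metric, in a parametrization `φ`:
`Δf = (det g)^(-1/2) ∑ᵢ ∂ᵢ ((det g)^(1/2) ∑ⱼ gⁱʲ ∂ⱼ f)`. -/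
def laplaceBeltrami {m n : ℕ} (φ : EuclideanSpace ℝ (Fin n) → Cn m)
    (f : EuclideanSpace ℝ (Fin n) → ℝ) (x : EuclideanSpace ℝ (Fin n)) : ℝ :=
  (Real.sqrt (inducedMetric φ x).det)⁻¹ *
    ∑ i, partialD i (fun y => Real.sqrt (inducedMetric φ y).det *
      ∑ j, (inducedMetric φ y)⁻¹ i j * partialD j f y) x

/-- `u` is a harmonic function on the `n`-dimensional submanifold `M` of `ℂᵐ` (with the induced
metric): in every local parametrization it is `C²` and annihilated by the Laplace-Beltrami
operator. Only the values of `u` on `M` matter. -/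
def IsHarmonicOn {m : ℕ} (n : ℕ) (M : Set (Cn m)) (u : Cn m → ℝ) : Prop :=
  ∀ (U : Set (EuclideanSpace ℝ (Fin n))) (φ : EuclideanSpace ℝ (Fin n) → Cn m),
    IsLocalParam M U φ →
      ContDiffOn ℝ 2 (u ∘ φ) U ∧ ∀ x ∈ U, laplaceBeltrami φ (u ∘ φ) x = 0

/-- `C` is a special Lagrangian cone in `ℂᵐ` with smooth connected link: a closed cone with
connected link `C ∩ S^{2m-1}`, such that `C \ {0}` is a smooth embedded `m`-dimensional
submanifold on which `ω` and `Im Ω` vanish. -/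
structure IsSpecialLagrangianCone {m : ℕ} (C : Set (Cn m)) : Prop where
  isClosed : IsClosed C
  cone : ∀ z ∈ C, ∀ t : ℝ, 0 ≤ t → t • z ∈ C
  link_connected : IsConnected (C ∩ Metric.sphere 0 1)
  specialLagrangian : ∀ z ∈ C \ {0},
    ∃ (U : Set (EuclideanSpace ℝ (Fin m))) (φ : EuclideanSpace ℝ (Fin m) → Cn m),
      IsLocalParam (C \ {0}) U φ ∧ z ∈ φ '' U ∧
      ∀ x ∈ U, (∀ i j, omega (partialD i φ x) (partialD j φ x) = 0) ∧
        (Omega fun i => partialD i φ x).im = 0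

/-- `u` has growth of order `d` on the cone `C`: `|u(z)| ≤ K |z|ᵈ` on all of `C \ {0}`. -/
def HasGrowth {m : ℕ} (C : Set (Cn m)) (d : ℕ) (u : Cn m → ℝ) : Prop :=
  ∃ K : ℝ, ∀ z ∈ C \ {0}, |u z| ≤ K * ‖z‖ ^ d

/-- The component `⟨μ, v⟩` of the moment map along a translation `v ∈ ℂᵐ`: the Hamiltonian `h`,
with `h(0) = 0` and `dh = ω(X, ·)`, of the constant vector field `X = v`. -/
def translationHamiltonian {m : ℕ} (v : Cn m) (z : Cn m) : ℝ := omega v z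

/-- The Lie algebra `su(m)`: trace-free skew-Hermitian matrices. -/
def su (m : ℕ) : Set (Matrix (Fin m) (Fin m) ℂ) :=
  {A | A.conjTranspose = -A ∧ A.trace = 0}

/-- The component `⟨μ, A⟩` of the moment map along `A ∈ su(m)`: the Hamiltonian `h`,
with `h(0) = 0` and `dh = ω(X, ·)`, of the linear vector field `X(z) = A z`. -/
def rotationHamiltonian {m : ℕ} (A : Matrix (Fin m) (Fin m) ℂ) (z : Cn m) : ℝ :=
  (1 / 2) * omega (Matrix.toEuclideanLin A z) z

/-- A special Lagrangian cone `C` in `ℂᵐ` is rigid if every harmonic function of linear growth on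
it is generated by a translation and every harmonic function of quadratic growth on it is
generated by an element of `su(m)`. -/
structure IsRigid {m : ℕ} (C : Set (Cn m)) : Prop where
  isSpecialLagrangianCone : IsSpecialLagrangianCone C
  linear : ∀ u : Cn m → ℝ, IsHarmonicOn m (C \ {0}) u → HasGrowth C 1 u →
    ∃ v : Cn m, ∀ z ∈ C \ {0}, u z = translationHamiltonian v z
  quadratic : ∀ u : Cn m → ℝ, IsHarmonicOn m (C \ {0}) u → HasGrowth C 2 u →
    ∃ A ∈ su m, ∀ z ∈ C \ {0}, u z = rotationHamiltonian A z

/-- The Harvey-Lawson cone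
`{z ∈ ℂᵐ : |z₁| = ⋯ = |zₘ|, Arg(i^(m+1) z₁ ⋯ zₘ) = 0}`; it contains the vertex `0`
because `Complex.arg 0 = 0`. -/
def harveyLawsonCone (m : ℕ) : Set (Cn m) :=
  {z | (∀ i j, ‖z i‖ = ‖z j‖) ∧ Complex.arg (Complex.I ^ (m + 1) * ∏ i, z i) = 0}

end HLRigid

end

/-!
The cone without its vertex has the global conformal parametrization `hlParam`,
`x ↦ ζ (exp (s + (xⱼ - s) i))ⱼ`, where `s` is the mean of `x ∈ ℝᵐ` and `ζ` is a unit complex number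
with `i^(m+1) ζ^m = 1`. The Hermitian products of its coordinate vectors are `e^(2s) δᵢⱼ`
(`inner_partialD_hlParam`), which gives both that the cone is Lagrangian and that its metric is
conformal to the flat one; the determinant of the coordinate vectors is real
(`Omega_partialD_hlParam`). The map is a covering, whose deck transformations are the translations
by `2 π {n ∈ ℤᵐ : ∑ n = 0}`, and its restrictions to small open sets are local parametrizations
(`isLocalParam_hlParam`).

For `u` harmonic on the cone, `F = u ∘ hlParam` is periodic under the deck transformations and
solves the equation with constant coefficients `∑ᵢ (∂ᵢ∂ᵢ F + (m - 2) / m ∂ᵢ F) = 0`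
(`IsHarmonicOn.comp_hlParam`). On each hyperplane of constant mean `s`, the linear map `torusMap`
turns `F` into a function on `(ℝ/ℤ)ᵐ`, which has a Fourier series. The coefficient `α(s)` of
frequency `k` satisfies `α'' + (m - 2) α' = (|k|² / m) α` (`fCoeff_ode`). If `u` has growth of
order `d`, then `|α(s)| ≤ K e^(ds)` for all `s`, from `-∞` to `∞`, which forces
`α(s) = α(0) e^(ds)`, and `α = 0` unless `|k|² = m d (d + m - 2)` (`eq_exp_of_growth`).
So only finitely many modes occur (`exists_finite_expansion`).

The frequencies that occur are `kᵢ = m nᵢ - ∑ n` with `n ∈ ℤᵐ` determined up to a constant, and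
`|k|² = m ∑_{i < j} (nᵢ - nⱼ)²`. For `d = 1` the equation `∑_{i < j} (nᵢ - nⱼ)² = m - 1` has only
the solutions `n = ±δⱼ` up to constants, and for `d = 2` and `m ≠ 8, 9` the equation
`∑_{i < j} (nᵢ - nⱼ)² = 2 m` has only the solutions `n = δᵢ - δⱼ` up to constants
(`exists_single_of_sum_sum_sub_sq`, `exists_sub_single_of_sum_sum_sub_sq`). The
corresponding functions on the cone are the real parts of multiples of `zⱼ`, and of `zᵢ z̄ⱼ`;
these are the Hamiltonians of translations and of root vectors of `su(m)`.
-/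

namespace HLRigid

noncomputable section

/-! ### Sums of squared differences of integers -/

section Lattice

variable {ι : Type*} [Fintype ι]

theorem sum_sum_sub_sq (n : ι → ℤ) :
    ∑ i, ∑ j, (n i - n j) ^ 2 =
      2 * (Fintype.card ι * ∑ i, n i ^ 2) - 2 * (∑ i, n i) ^ 2 := by
  have h : ∀ i j, (n i - n j) ^ 2 = n i ^ 2 + n j ^ 2 - 2 * (n i * n j) := fun i j => by ring
  simp only [h, Finset.sum_sub_distrib, Finset.sum_add_distrib, ← Finset.mul_sum,
    Finset.sum_const, Finset.card_univ, nsmul_eq_mul, ← Finset.sum_mul]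
  ring

/-- If the values of `n` spread over more than one unit, the sum of squared differences is at
least `4 * card ι`, and in the case of equality `n` is a root `δᵢ - δⱼ` up to a constant. -/
theorem sum_sum_sub_sq_of_two_le [DecidableEq ι] (n : ι → ℤ) {i j : ι} (hij : 2 ≤ n i - n j) :
    4 * (Fintype.card ι : ℤ) ≤ ∑ p, ∑ q, (n p - n q) ^ 2 ∧
      (∑ p, ∑ q, (n p - n q) ^ 2 = 4 * (Fintype.card ι : ℤ) →
        n i - n j = 2 ∧ ∀ l, l ≠ i → l ≠ j → n l = n j + 1) := by
  have hne : i ≠ j := by rintro rfl; simp at hij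
  set f : ι → ℤ := fun l => (n i - n l) ^ 2 + (n j - n l) ^ 2 with hf
  set R : ι → ℤ := fun p => ∑ q, (n p - n q) ^ 2 with hR
  have split : ∀ g : ι → ℤ, ∑ p, g p = g i + (g j + ∑ p ∈ (Finset.univ.erase i).erase j, g p) := by
    intro g
    rw [Finset.add_sum_erase _ g (Finset.mem_erase.2 ⟨hne.symm, Finset.mem_univ j⟩),
      Finset.add_sum_erase _ g (Finset.mem_univ i)]
  set T := (Finset.univ.erase i).erase j with hT
  have hcard : (T.card : ℤ) = Fintype.card ι - 2 := by
    have h1 := Finset.card_erase_add_one (Finset.mem_erase.2 ⟨hne.symm, Finset.mem_univ j⟩)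
    have h2 := Finset.card_erase_add_one (Finset.mem_univ i)
    rw [Finset.card_univ] at h2
    simp only [hT]
    lia
  -- the rows `i` and `j` add up to `f`, and every other row dominates its entries in the columns
  -- `i` and `j`; finally `f l ≥ 2`, with equality only if `n l` is the midpoint
  have h1 : R i + R j = 2 * (n i - n j) ^ 2 + ∑ l ∈ T, f l := by
    simp only [hR, ← Finset.sum_add_distrib]
    rw [split]
    simp only [hf]
    ring
  have h2 : ∑ l ∈ T, f l ≤ ∑ p ∈ T, R p := by
    refine Finset.sum_le_sum fun p _ => ?_
    simp only [hR]
    rw [split]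
    have : 0 ≤ ∑ q ∈ T, (n p - n q) ^ 2 := Finset.sum_nonneg fun _ _ => sq_nonneg _
    simp only [hf]
    nlinarith
  have h3 : ∑ l ∈ T, f l = ∑ l ∈ T, (f l - 2) + 2 * T.card := by
    rw [Finset.sum_sub_distrib, Finset.sum_const, nsmul_eq_mul]; ring
  have h4 : ∀ l ∈ T, 0 ≤ f l - 2 := fun l _ => by
    simp only [hf]
    nlinarith [sq_nonneg (n i - n l + (n j - n l))]
  have h5 := Finset.sum_nonneg h4
  have h6 : 4 ≤ (n i - n j) ^ 2 := by nlinarith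
  have hQ : ∑ p, ∑ q, (n p - n q) ^ 2 = R i + R j + ∑ p ∈ T, R p := by
    rw [split R]; ring
  rw [hQ]
  refine ⟨by linarith, fun h => ?_⟩
  have h7 : ∑ l ∈ T, (f l - 2) = 0 := by linarith
  have h8 : n i - n j = 2 := by nlinarith
  refine ⟨h8, fun l hli hlj => ?_⟩
  have h9 := (Finset.sum_eq_zero_iff_of_nonneg h4).1 h7 l (by simp [hT, hli, hlj])
  simp only [hf] at h9
  have h10 : (n l - n j - 1) ^ 2 = 0 := by
    have : n i = n j + 2 := by linarith
    rw [this] at h9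
    nlinarith
  have := pow_eq_zero_iff (two_ne_zero) |>.1 h10
  linarith

/-- An integer function takes values in some `{a, a + 1}`, or spreads over at least two units. -/
theorem exists_indicator_or_two_le [DecidableEq ι] [Nonempty ι] (n : ι → ℤ) :
    (∃ (a : ℤ) (S : Finset ι), ∀ i, n i = a + if i ∈ S then 1 else 0) ∨
      ∃ i j, 2 ≤ n i - n j := by
  obtain ⟨j, hj⟩ := Finite.exists_min n
  by_cases h : ∀ i, n i ≤ n j + 1
  · refine Or.inl ⟨n j, Finset.univ.filter fun i => n i = n j + 1, fun i => ?_⟩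
    have h1 := h i
    have h2 := hj i
    by_cases h3 : n i = n j + 1
    · simp [h3]
    · simp only [Finset.mem_filter, Finset.mem_univ, true_and, h3, if_false]
      lia
  · push Not at h
    obtain ⟨i, hi⟩ := h
    exact Or.inr ⟨i, j, by lia⟩

theorem sum_sum_sub_sq_indicator [DecidableEq ι] (n : ι → ℤ) (a : ℤ) (S : Finset ι)
    (h : ∀ i, n i = a + if i ∈ S then 1 else 0) :
    ∑ i, ∑ j, (n i - n j) ^ 2 = 2 * (S.card * (Fintype.card ι - S.card)) := by
  have h1 : ∀ i j, n i - n j = (if i ∈ S then (1 : ℤ) else 0) - if j ∈ S then 1 else 0 := by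
    intro i j; rw [h, h]; ring
  simp only [h1]
  rw [sum_sum_sub_sq fun i => if i ∈ S then (1 : ℤ) else 0]
  have h2 : ∀ i, (if i ∈ S then (1 : ℤ) else 0) ^ 2 = if i ∈ S then 1 else 0 := by
    intro i; split_ifs <;> simp
  simp only [h2, Finset.sum_boole, Finset.filter_mem_eq_inter, Finset.univ_inter]
  ring

/-- The frequencies of homogeneous harmonic functions of degree one: up to a constant they are
`±δⱼ`. -/
theorem exists_single_of_sum_sum_sub_sq [DecidableEq ι] [Nonempty ι] (n : ι → ℤ)
    (h : ∑ i, ∑ j, (n i - n j) ^ 2 = 2 * (Fintype.card ι - 1)) :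
    ∃ (a : ℤ) (j : ι), (∀ i, n i = a + if i = j then 1 else 0) ∨
      ∀ i, n i = a - if i = j then 1 else 0 := by
  rcases exists_indicator_or_two_le n with ⟨a, S, hS⟩ | ⟨i, j, hij⟩
  · rw [sum_sum_sub_sq_indicator n a S hS] at h
    have h1 : ((S.card : ℤ) - 1) * (Fintype.card ι - S.card - 1) = 0 := by linarith
    rcases mul_eq_zero.1 h1 with h1 | h1
    · obtain ⟨j, rfl⟩ := Finset.card_eq_one.1 (by lia : S.card = 1)
      exact ⟨a, j, Or.inl fun i => by rw [hS]; simp⟩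
    · have h2 : Sᶜ.card = 1 := by
        have := Finset.card_add_card_compl S
        lia
      obtain ⟨j, hj⟩ := Finset.card_eq_one.1 h2
      refine ⟨a + 1, j, Or.inr fun i => ?_⟩
      have h3 : i ∈ S ↔ i ≠ j := by
        rw [← not_iff_not, ← Finset.mem_compl, hj]; simp
      rw [hS]
      simp only [h3]
      by_cases hi : i = j <;> simp [hi]
  · have := (sum_sum_sub_sq_of_two_le n hij).1
    have hc : 0 < Fintype.card ι := Fintype.card_pos
    lia

/-- The frequencies of homogeneous harmonic functions of degree two: up to a constant they are
`δᵢ - δⱼ`. In the dimensions `8` and `9`, which are excluded, the indicator functions of subsets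
with `4`, respectively `3` or `6`, elements satisfy the same equation. -/
theorem exists_sub_single_of_sum_sum_sub_sq [DecidableEq ι] [Nonempty ι] (h8 : Fintype.card ι ≠ 8)
    (h9 : Fintype.card ι ≠ 9) (n : ι → ℤ)
    (h : ∑ i, ∑ j, (n i - n j) ^ 2 = 4 * Fintype.card ι) :
    ∃ (a : ℤ) (i j : ι), i ≠ j ∧
      ∀ l, n l = a + (if l = i then 1 else 0) - if l = j then 1 else 0 := by
  rcases exists_indicator_or_two_le n with ⟨a, S, hS⟩ | ⟨i, j, hij⟩
  · exfalso
    rw [sum_sum_sub_sq_indicator n a S hS] at h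
    have hc : 0 < Fintype.card ι := Fintype.card_pos
    have hle : S.card ≤ Fintype.card ι := Finset.card_le_univ S
    generalize S.card = p at *
    generalize Fintype.card ι = N at *
    -- `p (N - p) = 2 N` means `N (p - 2) = p ^ 2`, so that `p - 2` divides `4`.
    have h1 : (N : ℤ) * (p - 2) = p ^ 2 := by linarith
    have h2 : ((p : ℤ) - 2) ∣ 4 := by
      refine ⟨N - p - 2, ?_⟩
      linarith
    have h3 : ((p : ℤ) - 2) ≤ 4 := Int.le_of_dvd (by norm_num) h2
    have h4 : p ≤ 6 := by lia
    interval_cases p <;> norm_num at h1 <;> lia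
  · obtain ⟨h1, h2⟩ := (sum_sum_sub_sq_of_two_le n hij).2 h
    have hne : i ≠ j := by rintro rfl; simp at hij
    refine ⟨n j + 1, i, j, hne, fun l => ?_⟩
    by_cases hli : l = i
    · subst hli; simp [hne]; linarith
    · by_cases hlj : l = j
      · subst hlj; simp [hli]
      · simp [hli, hlj, h2 l hli hlj]

/-- A function with vanishing sum whose differences are divisible by `N = card ι` is
`N n - ∑ n`. -/
theorem exists_eq_card_mul_sub_sum [Nonempty ι] (k : ι → ℤ) (hsum : ∑ i, k i = 0)
    (hdvd : ∀ i j, (Fintype.card ι : ℤ) ∣ k i - k j) :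
    ∃ n : ι → ℤ, ∀ i, k i = Fintype.card ι * n i - ∑ j, n j := by
  obtain ⟨i₀⟩ := ‹Nonempty ι›
  choose n hn using fun i => hdvd i i₀
  refine ⟨n, fun i => ?_⟩
  have hN : (Fintype.card ι : ℤ) ≠ 0 := by
    have : 0 < Fintype.card ι := Fintype.card_pos_iff.2 ⟨i₀⟩
    lia
  have h1 : ∑ j, (k j - k i₀) = Fintype.card ι * ∑ j, n j := by
    rw [Finset.mul_sum]; exact Finset.sum_congr rfl fun j _ => hn j
  rw [Finset.sum_sub_distrib, hsum, Finset.sum_const, Finset.card_univ, nsmul_eq_mul] at h1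
  have h2 : k i₀ = -∑ j, n j := mul_left_cancel₀ hN (by linarith)
  linarith [hn i]

theorem sum_sq_eq_of_eq_card_mul_sub_sum (k n : ι → ℤ) (hsum : ∑ i, k i = 0)
    (hn : ∀ i, k i = Fintype.card ι * n i - ∑ j, n j) :
    2 * ∑ i, k i ^ 2 = Fintype.card ι * ∑ i, ∑ j, (n i - n j) ^ 2 := by
  have h1 : ∑ i, k i ^ 2 = Fintype.card ι * ∑ i, k i * n i := by
    have : ∀ i, k i ^ 2 = Fintype.card ι * (k i * n i) - k i * ∑ j, n j := fun i => by
      rw [sq]; nth_rewrite 2 [hn i]; ring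
    simp only [this, Finset.sum_sub_distrib, ← Finset.mul_sum, ← Finset.sum_mul, hsum, zero_mul,
      sub_zero]
  have h2 : ∑ i, k i * n i = Fintype.card ι * ∑ i, n i ^ 2 - (∑ j, n j) ^ 2 := by
    simp only [hn, sub_mul, Finset.sum_sub_distrib, ← Finset.mul_sum, mul_assoc, sq]
  rw [sum_sum_sub_sq, h1, h2]
  ring

end Lattice

/-! ### The conformal parametrization of the Harvey-Lawson cone -/

/-- Euclidean space `ℝᵐ`. -/
abbrev Rn (m : ℕ) : Type := EuclideanSpace ℝ (Fin m)

/-- The arithmetic mean of the coordinates, as a linear functional. -/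
def mean (m : ℕ) : Rn m →L[ℝ] ℝ := (m : ℝ)⁻¹ • ∑ j, EuclideanSpace.proj j

theorem mean_apply {m : ℕ} (x : Rn m) : mean m x = (m : ℝ)⁻¹ * ∑ j, x j := by
  simp [mean]

/-- The linear map `x ↦ s + (xⱼ - s) i`, where `s` is the mean of `x`: up to an additive constant,
the logarithm of the `j`-th coordinate of `hlParam`. -/
def logCoord (m : ℕ) (j : Fin m) : Rn m →L[ℝ] ℂ :=
  Complex.ofRealCLM ∘L mean m +
    Complex.I • (Complex.ofRealCLM ∘L (EuclideanSpace.proj j - mean m))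

theorem logCoord_apply {m : ℕ} (j : Fin m) (x : Rn m) :
    logCoord m j x = (mean m x : ℝ) + ((x j - mean m x : ℝ) : ℂ) * Complex.I := by
  simp [logCoord, mul_comm]

/-- A unit complex number `ζ` with `i^(m+1) ζ^m = 1`, so that `(ζ, …, ζ)` is in the
Harvey-Lawson cone. -/
def hlPhase (m : ℕ) : ℂ := Complex.exp ((-(Real.pi * (m + 1) / (2 * m)) : ℝ) * Complex.I)

/-- The parametrization `x ↦ ζ (exp (s + (xⱼ - s) i))ⱼ`, `s` the mean of `x`, of the Harvey-Lawson
cone without its vertex by all of `ℝᵐ`. It is a covering map, and it is conformal: the induced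
metric is `e^(2s)` times the Euclidean metric of `ℝᵐ`. -/
def hlParam (m : ℕ) (x : Rn m) : Cn m :=
  WithLp.toLp 2 fun j => hlPhase m * Complex.exp (logCoord m j x)

theorem hlParam_apply {m : ℕ} (x : Rn m) (j : Fin m) :
    hlParam m x j = hlPhase m * Complex.exp (logCoord m j x) := rfl

theorem norm_hlPhase (m : ℕ) : ‖hlPhase m‖ = 1 := Complex.norm_exp_ofReal_mul_I _

theorem hlPhase_ne_zero (m : ℕ) : hlPhase m ≠ 0 := Complex.exp_ne_zero _

theorem I_pow_mul_hlPhase_pow {m : ℕ} (hm : 1 ≤ m) :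
    Complex.I ^ (m + 1) * hlPhase m ^ m = 1 := by
  have h1 : Complex.I = Complex.exp (Real.pi / 2 * Complex.I) := Complex.exp_pi_div_two_mul_I.symm
  have hm0 : (m : ℂ) ≠ 0 := by exact_mod_cast (by lia : m ≠ 0)
  nth_rewrite 1 [h1]
  rw [hlPhase, ← Complex.exp_nat_mul, ← Complex.exp_nat_mul, ← Complex.exp_add,
    Complex.exp_eq_one_iff]
  refine ⟨0, ?_⟩
  push_cast
  field_simp
  ring

theorem sum_sub_mean {m : ℕ} (hm : 1 ≤ m) (x : Rn m) : ∑ j, (x j - mean m x) = 0 := by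
  have hm0 : (m : ℝ) ≠ 0 := by exact_mod_cast (by lia : m ≠ 0)
  rw [Finset.sum_sub_distrib, mean_apply, Finset.sum_const, Finset.card_univ, Fintype.card_fin,
    nsmul_eq_mul, mul_inv_cancel_left₀ hm0, sub_self]

theorem norm_hlParam_apply {m : ℕ} (x : Rn m) (j : Fin m) :
    ‖hlParam m x j‖ = Real.exp (mean m x) := by
  rw [hlParam_apply, norm_mul, norm_hlPhase, one_mul, Complex.norm_exp, logCoord_apply]
  simp

theorem hlParam_apply_ne_zero {m : ℕ} (x : Rn m) (j : Fin m) : hlParam m x j ≠ 0 :=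
  mul_ne_zero (hlPhase_ne_zero m) (Complex.exp_ne_zero _)

theorem norm_hlParam {m : ℕ} (x : Rn m) : ‖hlParam m x‖ = Real.sqrt m * Real.exp (mean m x) := by
  rw [EuclideanSpace.norm_eq]
  simp only [norm_hlParam_apply, Finset.sum_const, Finset.card_univ, Fintype.card_fin,
    nsmul_eq_mul]
  rw [Real.sqrt_mul (Nat.cast_nonneg m), Real.sqrt_sq (Real.exp_nonneg _)]

theorem I_pow_mul_prod_hlParam {m : ℕ} (hm : 1 ≤ m) (x : Rn m) :
    Complex.I ^ (m + 1) * ∏ j, hlParam m x j = (Real.exp (m * mean m x) : ℝ) := by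
  have h : ∑ j, logCoord m j x = ((m * mean m x : ℝ) : ℂ) := by
    simp only [logCoord_apply, Finset.sum_add_distrib, ← Finset.sum_mul, ← Complex.ofReal_sum,
      sum_sub_mean hm x]
    simp
  simp only [hlParam_apply, Finset.prod_mul_distrib, Finset.prod_const, Finset.card_univ,
    Fintype.card_fin]
  rw [← mul_assoc, I_pow_mul_hlPhase_pow hm, one_mul, ← Complex.exp_sum, h, Complex.ofReal_exp]

theorem hlParam_mem {m : ℕ} (hm : 1 ≤ m) (x : Rn m) :
    hlParam m x ∈ harveyLawsonCone m \ {0} := by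
  refine ⟨⟨fun i j => by rw [norm_hlParam_apply, norm_hlParam_apply], ?_⟩, fun h => ?_⟩
  · rw [I_pow_mul_prod_hlParam hm, Complex.arg_ofReal_of_nonneg (Real.exp_nonneg _)]
  · have h0 := hlParam_apply_ne_zero x ⟨0, hm⟩
    rw [Set.mem_singleton_iff.1 h] at h0
    exact h0 rfl

theorem mean_toLp_add {m : ℕ} (hm : 1 ≤ m) (s : ℝ) (y : Fin m → ℝ) (hy : ∑ j, y j = 0) :
    mean m (WithLp.toLp 2 fun j => s + y j) = s := by
  have hm0 : (m : ℝ) ≠ 0 := by exact_mod_cast (by lia : m ≠ 0)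
  rw [mean_apply]
  simp [Finset.sum_add_distrib, hy, hm0]

theorem hlParam_toLp_add {m : ℕ} (hm : 1 ≤ m) (s : ℝ) (y : Fin m → ℝ) (hy : ∑ j, y j = 0)
    (j : Fin m) :
    hlParam m (WithLp.toLp 2 fun j => s + y j) j =
      hlPhase m * Complex.exp (s + y j * Complex.I) := by
  rw [hlParam_apply, logCoord_apply, mean_toLp_add hm s y hy]
  simp

/-- `hlParam` is onto the cone without its vertex. -/
theorem exists_hlParam_eq {m : ℕ} (hm : 1 ≤ m) {z : Cn m} (hz : z ∈ harveyLawsonCone m \ {0}) :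
    ∃ x, hlParam m x = z := by
  obtain ⟨⟨hnorm, harg⟩, hz0⟩ := hz
  set j₀ : Fin m := ⟨0, hm⟩ with hj₀
  set r : ℝ := ‖z j₀‖ with hr
  have hzr : ∀ j, ‖z j‖ = r := fun j => hnorm j j₀
  have hr0 : 0 < r := by
    refine lt_of_le_of_ne (norm_nonneg _) fun h => hz0 ?_
    rw [Set.mem_singleton_iff]
    ext j
    have := hzr j
    rw [← h] at this
    simpa using this
  set θ : Fin m → ℝ := fun j => Complex.arg (z j / hlPhase m) with hθ
  have h1 : ∀ j, z j = hlPhase m * (r * Complex.exp (θ j * Complex.I)) := fun j => by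
    have := Complex.norm_mul_exp_arg_mul_I (z j / hlPhase m)
    rw [norm_div, norm_hlPhase, div_one, hzr] at this
    rw [this, mul_div_cancel₀ _ (hlPhase_ne_zero m)]
  have h2 : Complex.I ^ (m + 1) * ∏ j, z j =
      ((r ^ m : ℝ) : ℂ) * Complex.exp ((∑ j, θ j : ℝ) * Complex.I) := by
    simp only [h1, Finset.prod_mul_distrib, Finset.prod_const, Finset.card_univ, Fintype.card_fin]
    rw [← mul_assoc, I_pow_mul_hlPhase_pow hm, one_mul, ← Complex.exp_sum, ← Finset.sum_mul]
    push_cast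
    rfl
  -- the argument of the product is zero, so the angles add up to a multiple of `2 π`
  have h3 : Complex.exp ((∑ j, θ j : ℝ) * Complex.I) = 1 := by
    have h4 := Complex.norm_mul_exp_arg_mul_I (Complex.I ^ (m + 1) * ∏ j, z j)
    rw [harg, h2, norm_mul, Complex.norm_exp_ofReal_mul_I, mul_one, Complex.norm_real,
      Real.norm_of_nonneg (pow_nonneg hr0.le _)] at h4
    have h5 : ((r ^ m : ℝ) : ℂ) ≠ 0 := by exact_mod_cast (pow_pos hr0 m).ne'
    exact mul_left_cancel₀ h5 (by rw [← h4]; simp)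
  obtain ⟨N, hN⟩ := Complex.exp_eq_one_iff.1 h3
  have hN' : ∑ j, θ j = 2 * Real.pi * N := by
    have : ((∑ j, θ j : ℝ) : ℂ) = ((2 * Real.pi * N : ℝ) : ℂ) := by
      apply mul_right_cancel₀ Complex.I_ne_zero
      rw [hN]; push_cast; ring
    exact_mod_cast this
  set y : Fin m → ℝ := fun j => θ j - if j = j₀ then 2 * Real.pi * N else 0 with hy
  have hysum : ∑ j, y j = 0 := by
    simp [hy, Finset.sum_sub_distrib, hN']
  refine ⟨WithLp.toLp 2 fun j => Real.log r + y j, ?_⟩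
  ext j
  rw [hlParam_toLp_add hm _ y hysum, h1, Complex.exp_add, ← Complex.ofReal_exp, Real.exp_log hr0]
  congr 2
  by_cases hj : j = j₀
  · rw [Complex.exp_eq_exp_iff_exists_int]
    refine ⟨-N, ?_⟩
    simp only [hy, hj, if_true]
    push_cast
    ring
  · simp [hy, hj]

theorem contDiff_hlParam (m : ℕ) : ContDiff ℝ ∞ (hlParam m) := by
  rw [contDiff_piLp]
  intro j
  exact contDiff_const.mul (logCoord m j).contDiff.cexp

theorem fderiv_hlParam_apply {m : ℕ} (x v : Rn m) (j : Fin m) :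
    fderiv ℝ (hlParam m) x v j = hlParam m x j * logCoord m j v := by
  have h1 : HasFDerivAt (hlParam m) (fderiv ℝ (hlParam m) x) x :=
    ((contDiff_hlParam m).differentiable (by simp)).differentiableAt.hasFDerivAt
  have h2 := (PiLp.proj (𝕜 := ℝ) 2 (fun _ : Fin m => ℂ) j).hasFDerivAt.comp x h1
  have h3 : HasFDerivAt (fun y => hlPhase m * Complex.exp (logCoord m j y))
      (hlPhase m • Complex.exp (logCoord m j x) • logCoord m j) x :=
    ((logCoord m j).hasFDerivAt.cexp).const_mul _
  have h4 := congrArg (fun L => L v) (h2.unique h3)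
  simp only [ContinuousLinearMap.comp_apply, _root_.smul_apply, smul_eq_mul] at h4
  rw [hlParam_apply, mul_assoc, ← h4]
  rfl

theorem mean_single {m : ℕ} (i : Fin m) : mean m (EuclideanSpace.single i 1) = (m : ℝ)⁻¹ := by
  simp [mean_apply]

theorem partialD_hlParam_apply {m : ℕ} (x : Rn m) (i j : Fin m) :
    partialD i (hlParam m) x j = hlParam m x j *
      (((m : ℝ)⁻¹ : ℝ) + (((if j = i then 1 else 0) - (m : ℝ)⁻¹ : ℝ) : ℂ) * Complex.I) := by
  rw [partialD, fderiv_hlParam_apply, logCoord_apply, mean_single]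
  simp

/-- The Hermitian products of the coordinate vectors are real: `hlParam` is Lagrangian, and
conformal. -/
theorem inner_partialD_hlParam {m : ℕ} (hm : 1 ≤ m) (x : Rn m) (i k : Fin m) :
    inner ℂ (partialD i (hlParam m) x) (partialD k (hlParam m) x) =
      ((Real.exp (2 * mean m x) * if i = k then 1 else 0 : ℝ) : ℂ) := by
  have hm0 : (m : ℝ) ≠ 0 := by exact_mod_cast (by lia : m ≠ 0)
  rw [PiLp.inner_apply]
  have h1 : ∀ j, inner ℂ (partialD i (hlParam m) x j) (partialD k (hlParam m) x j) =
      ((Real.exp (2 * mean m x) * ((m : ℝ)⁻¹ * (m : ℝ)⁻¹ +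
        ((if j = i then 1 else 0) - (m : ℝ)⁻¹) * ((if j = k then 1 else 0) - (m : ℝ)⁻¹)) : ℝ) : ℂ) +
      ((Real.exp (2 * mean m x) * (m : ℝ)⁻¹ *
        ((if j = k then 1 else 0) - (if j = i then 1 else 0)) : ℝ) : ℂ) * Complex.I := by
    intro j
    have hn : (starRingEnd ℂ) (hlParam m x j) * hlParam m x j =
        (Real.exp (2 * mean m x) : ℝ) := by
      rw [← Complex.normSq_eq_conj_mul_self, Complex.normSq_eq_norm_sq, norm_hlParam_apply,
        ← Real.exp_nat_mul]
      norm_num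
    rw [partialD_hlParam_apply, partialD_hlParam_apply, RCLike.inner_apply', map_mul, map_add,
      map_mul, Complex.conj_ofReal, Complex.conj_ofReal, Complex.conj_I]
    have hI : Complex.I * Complex.I = -1 := Complex.I_mul_I
    generalize (if j = i then (1 : ℝ) else 0) = a
    generalize (if j = k then (1 : ℝ) else 0) = b
    push_cast at hn ⊢
    linear_combination (((m : ℂ)⁻¹ + ((a : ℂ) - (m : ℂ)⁻¹) * -Complex.I) *
      ((m : ℂ)⁻¹ + ((b : ℂ) - (m : ℂ)⁻¹) * Complex.I)) * hn -
      Complex.exp (2 * (mean m x : ℂ)) * ((a : ℂ) - (m : ℂ)⁻¹) * ((b : ℂ) - (m : ℂ)⁻¹) * hI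
  simp only [h1, Finset.sum_add_distrib, ← Finset.sum_mul, ← Complex.ofReal_sum, ← Finset.mul_sum]
  have h2 : ∑ j : Fin m, ((if j = k then (1 : ℝ) else 0) - (if j = i then 1 else 0)) = 0 := by
    simp [Finset.sum_sub_distrib]
  have h3 : (∑ _j : Fin m, (m : ℝ)⁻¹) * (m : ℝ)⁻¹ + ∑ j : Fin m, ((if j = i then (1 : ℝ) else 0) -
      (m : ℝ)⁻¹) * ((if j = k then 1 else 0) - (m : ℝ)⁻¹) = if i = k then 1 else 0 := by
    simp only [sub_mul, mul_sub, Finset.sum_sub_distrib, ← Finset.mul_sum, ← Finset.sum_mul]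
    simp only [Finset.sum_const, Finset.card_univ, Fintype.card_fin, nsmul_eq_mul,
      Finset.sum_ite_eq', Finset.mem_univ, if_true, mul_ite, mul_one, mul_zero,
      eq_comm (a := k) (b := i)]
    field_simp
    ring
  rw [h2, h3]
  simp

theorem inducedMetric_hlParam {m : ℕ} (hm : 1 ≤ m) (x : Rn m) :
    inducedMetric (hlParam m) x = Real.exp (2 * mean m x) • (1 : Matrix (Fin m) (Fin m) ℝ) := by
  ext i k
  simp only [inducedMetric, euclid, Matrix.of_apply, inner_partialD_hlParam hm, Complex.ofReal_re,
    Matrix.smul_apply, Matrix.one_apply, smul_eq_mul]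

theorem omega_partialD_hlParam {m : ℕ} (hm : 1 ≤ m) (x : Rn m) (i k : Fin m) :
    omega (partialD i (hlParam m) x) (partialD k (hlParam m) x) = 0 := by
  rw [omega, inner_partialD_hlParam hm, Complex.ofReal_im]

/-- The matrix of the coordinate vectors is `diag (hlParam)` times a rank-one perturbation of
`i • 1`. -/
theorem Omega_partialD_hlParam {m : ℕ} (hm : 1 ≤ m) (x : Rn m) :
    Omega (fun i => partialD i (hlParam m) x) = -(Real.exp (m * mean m x) : ℝ) := by
  have hm0 : (m : ℂ) ≠ 0 := by exact_mod_cast (by lia : m ≠ 0)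
  have h1 : (Matrix.of fun i j => partialD i (hlParam m) x j) =
      (Complex.I • (1 + Matrix.replicateCol Unit (fun _ => (1 : ℂ)) *
        Matrix.replicateRow Unit (fun _ => -Complex.I * (m : ℂ)⁻¹ * (1 - Complex.I)))) *
      Matrix.diagonal (hlParam m x) := by
    ext i j
    rw [Matrix.mul_diagonal, Matrix.of_apply, partialD_hlParam_apply]
    simp only [Matrix.smul_apply, Matrix.add_apply, Matrix.one_apply, Matrix.mul_apply,
      Matrix.replicateCol_apply, Matrix.replicateRow_apply, smul_eq_mul, eq_comm (a := i)]
    have hI : Complex.I * Complex.I = -1 := Complex.I_mul_I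
    simp only [Finset.univ_unique, Finset.sum_const, Finset.card_singleton, one_smul]
    generalize hlParam m x j = w
    split_ifs <;> push_cast <;>
    linear_combination (-w * (m : ℂ)⁻¹ * (Complex.I - 1)) * hI
  rw [Omega, h1, Matrix.det_mul, Matrix.det_smul, Matrix.det_one_add_replicateCol_mul_replicateRow,
    Matrix.det_diagonal, Fintype.card_fin, ← I_pow_mul_prod_hlParam hm]
  simp only [dotProduct, mul_one, Finset.sum_const, Finset.card_univ, Fintype.card_fin,
    nsmul_eq_mul]
  have h2 : 1 + (m : ℂ) * (-Complex.I * (m : ℂ)⁻¹ * (1 - Complex.I)) = -Complex.I := by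
    field_simp
    linear_combination (1 : ℂ) * Complex.I_mul_I
  rw [h2]
  ring

/-! ### The Harvey-Lawson cone is special Lagrangian -/

/-- An open set containing `x₀` on which `hlParam` is injective: the angles `xⱼ - s`, which add up
to zero, vary by less than `π / m`. -/
def hlDomain (m : ℕ) (x₀ : Rn m) : Set (Rn m) :=
  {x | ∀ j, |(x j - mean m x) - (x₀ j - mean m x₀)| < Real.pi / m}

theorem mem_hlDomain {m : ℕ} (hm : 1 ≤ m) (x₀ : Rn m) : x₀ ∈ hlDomain m x₀ := by
  intro j
  have : (0 : ℝ) < m := by exact_mod_cast hm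
  rw [sub_self, abs_zero]
  positivity

theorem isOpen_hlDomain (m : ℕ) (x₀ : Rn m) : IsOpen (hlDomain m x₀) := by
  have : hlDomain m x₀ =
      ⋂ j, {x | |(x j - mean m x) - (x₀ j - mean m x₀)| < Real.pi / m} := by
    ext x; simp [hlDomain]
  rw [this]
  refine isOpen_iInter_of_finite fun j => isOpen_lt ?_ continuous_const
  fun_prop

/-- The `j`-th coordinate of a point of the cone, relative to the angles of `hlParam m x₀`. -/
def hlRatio (m : ℕ) (x₀ : Rn m) (j : Fin m) (z : Cn m) : ℂ :=
  z j / (hlPhase m * Complex.exp ((x₀ j - mean m x₀ : ℝ) * Complex.I))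

theorem continuous_hlRatio (m : ℕ) (x₀ : Rn m) (j : Fin m) : Continuous (hlRatio m x₀ j) := by
  unfold hlRatio
  fun_prop

theorem eq_hlRatio_mul {m : ℕ} (x₀ : Rn m) (j : Fin m) (z : Cn m) :
    z j = hlPhase m * Complex.exp ((x₀ j - mean m x₀ : ℝ) * Complex.I) * hlRatio m x₀ j z :=
  (mul_div_cancel₀ _ (mul_ne_zero (hlPhase_ne_zero m) (Complex.exp_ne_zero _))).symm

theorem hlRatio_hlParam {m : ℕ} (x₀ x : Rn m) (j : Fin m) :
    hlRatio m x₀ j (hlParam m x) = Complex.exp ((mean m x : ℝ) +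
      (((x j - mean m x) - (x₀ j - mean m x₀) : ℝ) : ℂ) * Complex.I) := by
  rw [hlRatio, hlParam_apply, mul_div_mul_left _ _ (hlPhase_ne_zero m), ← Complex.exp_sub,
    logCoord_apply]
  congr 1
  push_cast
  ring

theorem log_exp_of_abs_lt {s y : ℝ} (hy : |y| < Real.pi) :
    Complex.log (Complex.exp (s + y * Complex.I)) = s + y * Complex.I := by
  rw [abs_lt] at hy
  apply Complex.log_exp <;> simp <;> linarith

theorem exp_mem_slitPlane {s y : ℝ} (hy : |y| < Real.pi) :
    Complex.exp (s + y * Complex.I) ∈ Complex.slitPlane := by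
  rw [Complex.mem_slitPlane_iff_arg]
  refine ⟨?_, Complex.exp_ne_zero _⟩
  rw [← Complex.log_im, log_exp_of_abs_lt hy]
  simpa using (abs_lt.1 hy).2.ne

theorem pi_div_le {m : ℕ} (hm : 1 ≤ m) : Real.pi / m ≤ Real.pi :=
  div_le_self Real.pi_pos.le (by exact_mod_cast hm)

/-- A left inverse of `hlParam` on `hlDomain m x₀`. -/
def hlChart (m : ℕ) (x₀ : Rn m) (z : Cn m) : Rn m :=
  WithLp.toLp 2 fun j => (Complex.log (hlRatio m x₀ j z)).re +
    ((Complex.log (hlRatio m x₀ j z)).im + (x₀ j - mean m x₀))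

theorem hlChart_hlParam {m : ℕ} (hm : 1 ≤ m) {x₀ x : Rn m} (hx : x ∈ hlDomain m x₀) :
    hlChart m x₀ (hlParam m x) = x := by
  ext j
  simp only [hlChart, hlRatio_hlParam]
  rw [log_exp_of_abs_lt ((hx j).trans_le (pi_div_le hm))]
  simp

/-- The points of `ℂᵐ` whose coordinates have an angle of less than `π / m` with those of
`hlParam m x₀`. -/
def hlTarget (m : ℕ) (x₀ : Rn m) : Set (Cn m) :=
  {z | ∀ j, hlRatio m x₀ j z ∈ Complex.slitPlane ∧ |Complex.arg (hlRatio m x₀ j z)| < Real.pi / m}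

theorem isOpen_hlTarget (m : ℕ) (x₀ : Rn m) : IsOpen (hlTarget m x₀) := by
  have h1 : IsOpen {w : ℂ | w ∈ Complex.slitPlane ∧ |Complex.arg w| < Real.pi / m} := by
    have h2 : ContinuousOn (fun w : ℂ => |Complex.arg w|) Complex.slitPlane := fun w hw =>
      (Complex.continuousAt_arg hw).abs.continuousWithinAt
    exact h2.isOpen_inter_preimage Complex.isOpen_slitPlane (isOpen_Iio (a := Real.pi / m))
  have h3 : hlTarget m x₀ = ⋂ j, hlRatio m x₀ j ⁻¹'
      {w : ℂ | w ∈ Complex.slitPlane ∧ |Complex.arg w| < Real.pi / m} := by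
    ext z; simp [hlTarget]
  rw [h3]
  exact isOpen_iInter_of_finite fun j => h1.preimage (continuous_hlRatio m x₀ j)

theorem image_hlDomain {m : ℕ} (hm : 1 ≤ m) (x₀ : Rn m) :
    hlParam m '' hlDomain m x₀ = (harveyLawsonCone m \ {0}) ∩ hlTarget m x₀ := by
  have hm0 : (0 : ℝ) < m := by exact_mod_cast hm
  apply Set.Subset.antisymm
  · rintro _ ⟨x, hx, rfl⟩
    refine ⟨hlParam_mem hm x, fun j => ?_⟩
    have h1 := (hx j).trans_le (pi_div_le hm)
    rw [hlRatio_hlParam]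
    refine ⟨exp_mem_slitPlane h1, ?_⟩
    rw [← Complex.log_im, log_exp_of_abs_lt h1]
    simpa using hx j
  · rintro z ⟨hz, hzt⟩
    obtain ⟨x, rfl⟩ := exists_hlParam_eq hm hz
    set δ : Fin m → ℝ := fun j => Complex.arg (hlRatio m x₀ j (hlParam m x)) with hδ
    have h1 : ∀ j, hlRatio m x₀ j (hlParam m x) =
        Complex.exp ((mean m x : ℝ) + δ j * Complex.I) := fun j => by
      have h2 := Complex.norm_mul_exp_arg_mul_I (hlRatio m x₀ j (hlParam m x))
      rw [Complex.exp_add, ← Complex.ofReal_exp]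
      have h3 : ‖hlRatio m x₀ j (hlParam m x)‖ = Real.exp (mean m x) := by
        rw [hlRatio_hlParam, Complex.norm_exp]; simp
      rw [h3] at h2
      exact h2.symm
    -- the sum of the angles `δⱼ` is a multiple of `2 π` of absolute value less than `π`
    have h2 : Complex.exp ((∑ j, δ j : ℝ) * Complex.I) = 1 := by
      have h3 : ∀ j, Complex.exp (δ j * Complex.I) = Complex.exp
          ((((x j - mean m x) - (x₀ j - mean m x₀) : ℝ) : ℂ) * Complex.I) := fun j => by
        have h4 := (h1 j).symm.trans (hlRatio_hlParam x₀ x j)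
        rw [Complex.exp_add, Complex.exp_add] at h4
        exact mul_left_cancel₀ (Complex.exp_ne_zero _) h4
      rw [Complex.ofReal_sum, Finset.sum_mul, Complex.exp_sum]
      simp only [h3]
      rw [← Complex.exp_sum, ← Finset.sum_mul, ← Complex.ofReal_sum, Finset.sum_sub_distrib,
        sum_sub_mean hm, sum_sub_mean hm]
      simp
    have h5 : |∑ j, δ j| < Real.pi := by
      calc |∑ j, δ j| ≤ ∑ j, |δ j| := Finset.abs_sum_le_sum_abs _ _
        _ < ∑ _j : Fin m, Real.pi / m :=
          Finset.sum_lt_sum_of_nonempty ⟨⟨0, hm⟩, Finset.mem_univ _⟩ fun j _ => (hzt j).2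
        _ = Real.pi := by simp; field_simp
    have h6 : ∑ j, δ j = 0 := by
      have h7 := log_exp_of_abs_lt (s := 0) h5
      rw [Complex.ofReal_zero, zero_add, h2, Complex.log_one] at h7
      exact_mod_cast (mul_eq_zero.1 h7.symm).resolve_right Complex.I_ne_zero
    have h8 : ∑ j, (δ j + (x₀ j - mean m x₀)) = 0 := by
      rw [Finset.sum_add_distrib, h6, sum_sub_mean hm, add_zero]
    refine ⟨WithLp.toLp 2 fun j => mean m x + (δ j + (x₀ j - mean m x₀)), fun j => ?_, ?_⟩
    · rw [mean_toLp_add hm _ _ h8]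
      simpa using (hzt j).2
    · ext j
      rw [hlParam_toLp_add hm _ _ h8, eq_hlRatio_mul x₀ j (hlParam m x), h1, mul_assoc,
        ← Complex.exp_add]
      congr 2
      push_cast
      ring

/-- The restriction of `hlParam` to `hlDomain m x₀` is an embedding, because it has the left inverse
`hlChart m x₀`, which is continuous on the open set `hlTarget m x₀`. -/
theorem isEmbedding_hlParam {m : ℕ} (hm : 1 ≤ m) (x₀ : Rn m) :
    Topology.IsEmbedding ((hlDomain m x₀).domRestrict (hlParam m)) := by
  have hmem : ∀ x : hlDomain m x₀, hlParam m x ∈ hlTarget m x₀ := fun x =>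
    ((image_hlDomain hm x₀).subset ⟨x, x.2, rfl⟩).2
  have hcont : Continuous (fun x : hlDomain m x₀ => hlParam m x) :=
    (contDiff_hlParam m).continuous.comp continuous_subtype_val
  set f : hlDomain m x₀ → hlTarget m x₀ := fun x => ⟨hlParam m x, hmem x⟩ with hf
  set g : hlTarget m x₀ → Rn m := fun z => hlChart m x₀ z with hg
  have hgc : Continuous g := by
    have h1 : ∀ j, Continuous fun z : hlTarget m x₀ => Complex.log (hlRatio m x₀ j z) := fun j =>
      ((continuous_hlRatio m x₀ j).comp continuous_subtype_val).clog fun z => (z.2 j).1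
    refine (PiLp.continuous_toLp 2 _).comp (continuous_pi fun j => ?_)
    exact (Complex.continuous_re.comp (h1 j)).add
      ((Complex.continuous_im.comp (h1 j)).add continuous_const)
  have hgf : g ∘ f = Subtype.val := by
    ext1 x
    exact hlChart_hlParam hm x.2
  have h2 : Topology.IsEmbedding f :=
    .of_comp (hcont.subtype_mk _) hgc (hgf ▸ Topology.IsEmbedding.subtypeVal)
  exact Topology.IsEmbedding.subtypeVal.comp h2

theorem injective_fderiv_hlParam {m : ℕ} (x : Rn m) :
    Function.Injective (fderiv ℝ (hlParam m) x) := by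
  rw [injective_iff_map_eq_zero]
  intro v hv
  have h1 : ∀ j, logCoord m j v = 0 := fun j => by
    have h2 := fderiv_hlParam_apply x v j
    rw [hv] at h2
    exact (mul_eq_zero.1 h2.symm).resolve_left (hlParam_apply_ne_zero x j)
  ext j
  have h3 := h1 j
  rw [logCoord_apply] at h3
  have hre := congrArg Complex.re h3
  have him := congrArg Complex.im h3
  simp at hre him
  simp [hre] at him
  simpa using him

theorem isLocalParam_hlParam {m : ℕ} (hm : 1 ≤ m) (x₀ : Rn m) :
    IsLocalParam (harveyLawsonCone m \ {0}) (hlDomain m x₀) (hlParam m) where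
  isOpen := isOpen_hlDomain m x₀
  smooth := (contDiff_hlParam m).contDiffOn
  immersion x _ := injective_fderiv_hlParam x
  embedding := isEmbedding_hlParam hm x₀
  image_open := ⟨hlTarget m x₀, isOpen_hlTarget m x₀, image_hlDomain hm x₀⟩

theorem isClosed_harveyLawsonCone (m : ℕ) : IsClosed (harveyLawsonCone m) := by
  have h1 : harveyLawsonCone m = (⋂ i, ⋂ j, {z : Cn m | ‖z i‖ = ‖z j‖}) ∩
      ({z : Cn m | 0 ≤ (Complex.I ^ (m + 1) * ∏ i, z i).re} ∩
        {z : Cn m | (Complex.I ^ (m + 1) * ∏ i, z i).im = 0}) := by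
    ext z
    simp [harveyLawsonCone, Complex.arg_eq_zero_iff]
  rw [h1]
  refine IsClosed.inter ?_ (IsClosed.inter ?_ ?_)
  · exact isClosed_iInter fun i => isClosed_iInter fun j =>
      isClosed_eq (by fun_prop) (by fun_prop)
  · exact isClosed_le (by fun_prop) (by fun_prop)
  · exact isClosed_eq (by fun_prop) (by fun_prop)

theorem smul_mem_harveyLawsonCone {m : ℕ} (hm : 1 ≤ m) {z : Cn m} (hz : z ∈ harveyLawsonCone m)
    {t : ℝ} (ht : 0 ≤ t) : t • z ∈ harveyLawsonCone m := by
  obtain ⟨h1, h2⟩ := hz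
  refine ⟨fun i j => by simp [h1 i j], ?_⟩
  have h3 : Complex.I ^ (m + 1) * ∏ i, (t • z) i =
      ((t ^ m : ℝ) : ℂ) * (Complex.I ^ (m + 1) * ∏ i, z i) := by
    simp only [PiLp.smul_apply, Complex.real_smul, Finset.prod_mul_distrib, Finset.prod_const,
      Finset.card_univ, Fintype.card_fin]
    push_cast
    ring
  rw [h3]
  rcases ht.eq_or_lt with rfl | ht
  · rw [zero_pow (by lia)]; simp
  · rw [Complex.arg_real_mul _ (pow_pos ht m), h2]

/-- The link is the image of the connected space `ℝᵐ` under `hlParam`, normalized. -/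
theorem isConnected_link {m : ℕ} (hm : 1 ≤ m) :
    IsConnected (harveyLawsonCone m ∩ Metric.sphere 0 1) := by
  have h1 : harveyLawsonCone m ∩ Metric.sphere 0 1 =
      Set.range fun x => ‖hlParam m x‖⁻¹ • hlParam m x := by
    ext z
    constructor
    · rintro ⟨hz, hz1⟩
      rw [mem_sphere_zero_iff_norm] at hz1
      obtain ⟨x, rfl⟩ := exists_hlParam_eq hm (z := z) ⟨hz, fun h => by
        rw [Set.mem_singleton_iff.1 h] at hz1; simp at hz1⟩
      exact ⟨x, by simp [hz1]⟩
    · rintro ⟨x, rfl⟩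
      have h2 := hlParam_mem hm x
      refine ⟨smul_mem_harveyLawsonCone hm h2.1 (inv_nonneg.2 (norm_nonneg _)), ?_⟩
      rw [mem_sphere_zero_iff_norm, norm_smul, norm_inv, norm_norm]
      exact inv_mul_cancel₀ (norm_ne_zero_iff.2 h2.2)
  rw [h1]
  have h3 : Continuous (hlParam m) := (contDiff_hlParam m).continuous
  exact isConnected_range ((h3.norm.inv₀ fun x => norm_ne_zero_iff.2 (hlParam_mem hm x).2).smul h3)

theorem isSpecialLagrangianCone_harveyLawsonCone {m : ℕ} (hm : 1 ≤ m) :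
    IsSpecialLagrangianCone (harveyLawsonCone m) where
  isClosed := isClosed_harveyLawsonCone m
  cone _ hz _ ht := smul_mem_harveyLawsonCone hm hz ht
  link_connected := isConnected_link hm
  specialLagrangian z hz := by
    obtain ⟨x₀, rfl⟩ := exists_hlParam_eq hm hz
    refine ⟨hlDomain m x₀, hlParam m, isLocalParam_hlParam hm x₀,
      ⟨x₀, mem_hlDomain hm x₀, rfl⟩, fun x _ => ⟨fun i j => omega_partialD_hlParam hm x i j, ?_⟩⟩
    rw [Omega_partialD_hlParam hm, ← Complex.ofReal_neg, Complex.ofReal_im]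

theorem sqrt_det_mul_inv_inducedMetric {m : ℕ} (hm : 1 ≤ m) (x : Rn m) (i j : Fin m) :
    Real.sqrt (inducedMetric (hlParam m) x).det * (inducedMetric (hlParam m) x)⁻¹ i j =
      Real.exp ((m - 2) * mean m x) * if i = j then 1 else 0 := by
  have h1 : Real.sqrt (inducedMetric (hlParam m) x).det = Real.exp (m * mean m x) := by
    rw [inducedMetric_hlParam hm, Matrix.det_smul, Matrix.det_one, mul_one, Fintype.card_fin,
      ← Real.exp_nat_mul, show (m : ℝ) * (2 * mean m x) = m * mean m x + m * mean m x by ring,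
      Real.exp_add, Real.sqrt_mul_self (Real.exp_nonneg _)]
  have h2 : (inducedMetric (hlParam m) x)⁻¹ =
      Real.exp (-(2 * mean m x)) • (1 : Matrix (Fin m) (Fin m) ℝ) := by
    apply Matrix.inv_eq_right_inv
    rw [inducedMetric_hlParam hm, Matrix.smul_mul, Matrix.one_mul, smul_smul, ← Real.exp_add]
    simp
  rw [h1, h2, Matrix.smul_apply, Matrix.one_apply, smul_eq_mul, ← mul_assoc, ← Real.exp_add]
  congr 2
  ring

/-- In the conformal parametrization `hlParam`, harmonicity is an equation with constant
coefficients. -/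
theorem IsHarmonicOn.comp_hlParam {m : ℕ} (hm : 1 ≤ m) {u : Cn m → ℝ}
    (hu : IsHarmonicOn m (harveyLawsonCone m \ {0}) u) :
    ContDiff ℝ 2 (u ∘ hlParam m) ∧ ∀ x,
      ∑ i, partialD i (partialD i (u ∘ hlParam m)) x +
        (m - 2) / m * ∑ i, partialD i (u ∘ hlParam m) x = 0 := by
  have h1 := fun x₀ => hu (hlDomain m x₀) (hlParam m) (isLocalParam_hlParam hm x₀)
  have hC2 : ContDiff ℝ 2 (u ∘ hlParam m) := contDiff_iff_contDiffAt.2 fun x =>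
    (h1 x).1.contDiffAt ((isOpen_hlDomain m x).mem_nhds (mem_hlDomain hm x))
  refine ⟨hC2, fun x => ?_⟩
  have h2 := (h1 x).2 x (mem_hlDomain hm x)
  set F := u ∘ hlParam m with hF
  have h3 : ∀ (i : Fin m) (y : Rn m), Real.sqrt (inducedMetric (hlParam m) y).det *
      ∑ j, (inducedMetric (hlParam m) y)⁻¹ i j * partialD j F y =
      Real.exp ((m - 2) * mean m y) * partialD i F y := by
    intro i y
    rw [Finset.mul_sum]
    simp only [← mul_assoc, sqrt_det_mul_inv_inducedMetric hm]
    simp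
  have h4 : ∀ i, DifferentiableAt ℝ (partialD i F) x := fun i => by
    have h5 : ContDiff ℝ 1 (partialD i F) :=
      (hC2.fderiv_right (m := 1) (by norm_num)).clm_apply contDiff_const
    exact (h5.differentiable (by norm_num)).differentiableAt
  have h6 : ∀ i, partialD i (fun y => Real.exp ((m - 2) * mean m y) * partialD i F y) x =
      Real.exp ((m - 2) * mean m x) *
        (partialD i (partialD i F) x + (m - 2) / m * partialD i F x) := by
    intro i
    have h7 : HasFDerivAt (fun y => Real.exp ((m - 2) * mean m y))
        (Real.exp ((m - 2) * mean m x) • ((m - 2 : ℝ) • mean m)) x :=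
      ((mean m).hasFDerivAt.const_mul (m - 2 : ℝ)).exp
    have h8 : HasFDerivAt (fun y => Real.exp ((m - 2) * mean m y) * partialD i F y) _ x :=
      h7.mul (h4 i).hasFDerivAt
    rw [partialD, h8.fderiv]
    simp only [_root_.add_apply, _root_.smul_apply, smul_eq_mul, mean_single]
    simp only [partialD]
    ring
  simp only [laplaceBeltrami, h3, h6, ← Finset.mul_sum] at h2
  rw [Finset.sum_add_distrib, ← Finset.mul_sum] at h2
  rcases mul_eq_zero.1 h2 with h8 | h8
  · rw [inv_eq_zero, inducedMetric_hlParam hm, Real.sqrt_eq_zero'] at h8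
    exfalso
    rw [Matrix.det_smul, Matrix.det_one, mul_one] at h8
    exact absurd h8 (not_le.2 (pow_pos (Real.exp_pos _) _))
  · exact (mul_eq_zero.1 h8).resolve_left (Real.exp_ne_zero _)

/-! ### An ordinary differential equation with bounded growth -/

open Complex in
/-- A solution of `f' = c f` is an exponential. -/
theorem eq_exp_of_hasDerivAt {f : ℝ → ℂ} {c : ℂ} (h : ∀ s, HasDerivAt f (c * f s) s) (s : ℝ) :
    f s = f 0 * exp (c * s) := by
  have h1 : ∀ t : ℝ, HasDerivAt (fun t : ℝ => f t * exp (-(c * t))) 0 t := by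
    intro t
    have h2 : HasDerivAt (fun t : ℝ => -(c * (t : ℂ))) (-(c * 1)) t :=
      ((hasDerivAt_id t).ofReal_comp.const_mul c).neg
    refine ((h t).mul h2.cexp).congr_deriv ?_
    ring
  have h4 :=
    is_const_of_deriv_eq_zero (fun t => (h1 t).differentiableAt) (fun t => (h1 t).deriv) s 0
  simp only [ofReal_zero, mul_zero, neg_zero, exp_zero, mul_one] at h4
  rw [← h4, mul_assoc, ← exp_add]
  simp

open Filter Topology in
/-- A bounded solution of `β' - b β = w e^{as}` with `a < 0` exists only if `w = 0`, since the right
side is unbounded at `-∞`. -/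
theorem eq_zero_of_bounded_of_hasDerivAt {β : ℝ → ℂ} {a b K : ℝ} {w : ℂ} (ha : a < 0)
    (hbd : ∀ s, ‖β s‖ ≤ K)
    (h : ∀ s, HasDerivAt β (b * β s + w * Complex.exp (a * s)) s) : w = 0 := by
  -- `γ = e^{-as} β` tends to zero at `-∞` and satisfies `γ' = (b - a) γ + w`.
  set γ : ℝ → ℂ := fun s => β s * Complex.exp (-(a * s)) with hγ
  have hγ' : ∀ s, HasDerivAt γ ((b - a) * γ s + w) s := by
    intro s
    have h2 : HasDerivAt (fun t : ℝ => -((a : ℂ) * (t : ℂ))) (-((a : ℂ) * 1)) s :=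
      ((hasDerivAt_id s).ofReal_comp.const_mul (a : ℂ)).neg
    refine ((h s).mul h2.cexp).congr_deriv ?_
    have h3 : Complex.exp (a * s) * Complex.exp (-(a * s)) = 1 := by
      rw [← Complex.exp_add, add_neg_cancel, Complex.exp_zero]
    simp only [hγ]
    linear_combination w * h3
  have hlim : Tendsto γ atBot (𝓝 0) := by
    rw [tendsto_zero_iff_norm_tendsto_zero]
    have h3 : Tendsto (fun s : ℝ => K * Real.exp (-(a * s))) atBot (𝓝 (K * 0)) := by
      refine (Real.tendsto_exp_atBot.comp ?_).const_mul K
      have : (fun s : ℝ => -(a * s)) = fun s => (-a) * s := by ext; ring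
      rw [this]
      exact tendsto_id.const_mul_atBot (by linarith)
    rw [mul_zero] at h3
    refine squeeze_zero (fun _ => norm_nonneg _) (fun s => ?_) h3
    rw [hγ, norm_mul, Complex.norm_exp]
    simpa using mul_le_mul_of_nonneg_right (hbd s) (Real.exp_nonneg _)
  -- by the mean value inequality, `γ (s + 1) - γ s` is close to `w`
  have hdiff : Tendsto (fun s => γ (s + 1) - γ s) atBot (𝓝 0) := by
    have : Tendsto (fun s : ℝ => s + 1) atBot atBot := tendsto_atBot_add_const_right _ _ tendsto_id
    simpa using (hlim.comp this).sub hlim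
  have hclose : Tendsto (fun s => γ (s + 1) - γ s) atBot (𝓝 w) := by
    rw [Metric.tendsto_nhds]
    intro ε hε
    have h5 : Tendsto (fun s => ((b - a : ℝ) : ℂ) * γ s) atBot (𝓝 0) := by
      simpa using hlim.const_mul ((b - a : ℝ) : ℂ)
    obtain ⟨T, hT⟩ := eventually_atBot.1 ((Metric.tendsto_nhds.1 h5) (ε / 2) (by linarith))
    filter_upwards [eventually_le_atBot (T - 1)] with s hs
    have h6 : ∀ t ∈ Set.Icc s (s + 1), HasDerivWithinAt (fun t : ℝ => γ t - t * w)
        ((b - a) * γ t) (Set.Icc s (s + 1)) t := by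
      intro t _
      refine (((hγ' t).sub ((hasDerivAt_id t).ofReal_comp.mul_const w)).congr_deriv
        ?_).hasDerivWithinAt
      push_cast
      ring
    have h7 : ∀ t ∈ Set.Ico s (s + 1), ‖((b : ℂ) - a) * γ t‖ ≤ ε / 2 := by
      intro t ht
      have := hT t (by linarith [ht.2])
      rw [dist_zero_right] at this
      push_cast at this
      exact this.le
    have h8 := norm_image_sub_le_of_norm_deriv_le_segment' h6 h7 (s + 1) ⟨by linarith, le_rfl⟩
    rw [dist_eq_norm]
    have h9 : γ (s + 1) - γ s - w =
        γ (s + 1) - ((s + 1 : ℝ) : ℂ) * w - (γ s - s * w) := by push_cast; ring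
    rw [h9]
    linarith
  exact tendsto_nhds_unique hclose hdiff

theorem eq_zero_of_bounded_exp {A : ℂ} {b K : ℝ} (h : ∀ s : ℝ, ‖A * Complex.exp (b * s)‖ ≤ K)
    (hb : b ≠ 0) : A = 0 := by
  by_contra hA
  have hA' : 0 < ‖A‖ := norm_pos_iff.2 hA
  have h1 := h ((K / ‖A‖) / b)
  rw [norm_mul, Complex.norm_exp] at h1
  have h2 : (((b : ℂ) * ((K / ‖A‖ / b : ℝ) : ℂ))).re = K / ‖A‖ := by
    rw [← Complex.ofReal_mul, Complex.ofReal_re]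
    field_simp
  rw [h2] at h1
  have h3 := Real.add_one_le_exp (K / ‖A‖)
  have h4 : ‖A‖ * (K / ‖A‖ + 1) = K + ‖A‖ := by field_simp
  nlinarith

/-- The solutions of `α'' + n α' = μ α` (`μ ≥ 0`) with `|α(s)| ≤ K e^{ds}` on the whole line are
multiples of `e^{ds}`, and they vanish unless `d` is a root of the characteristic polynomial. -/
theorem eq_exp_of_growth {α α₁ : ℝ → ℂ} {n μ d K : ℝ} (hμ : 0 ≤ μ) (hd : 0 < n + 2 * d)
    (h1 : ∀ s, HasDerivAt α (α₁ s) s) (h2 : ∀ s, HasDerivAt α₁ (μ * α s - n * α₁ s) s)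
    (hK : ∀ s, ‖α s‖ ≤ K * Real.exp (d * s)) :
    (∀ s, α s = α 0 * Complex.exp (d * s)) ∧ (d ^ 2 + n * d ≠ μ → α 0 = 0) := by
  set r : ℝ := Real.sqrt (n ^ 2 + 4 * μ) with hr
  have hr0 : 0 ≤ r := Real.sqrt_nonneg _
  have hr2 : r ^ 2 = n ^ 2 + 4 * μ := Real.sq_sqrt (by positivity)
  -- the roots `p ≤ q` of `X² + n X - μ`
  set p : ℝ := (-n - r) / 2 with hp
  set q : ℝ := (-n + r) / 2 with hq
  have hpq : p ≤ q := by rw [hp, hq]; linarith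
  have hpd : p < d := by rw [hp]; linarith
  have hsum : p + q = -n := by rw [hp, hq]; ring
  have hprod : p * q = -μ := by
    rw [hp, hq]
    linear_combination (-1 / 4 : ℝ) * hr2
  have hsum' : (p : ℂ) + q = -n := by exact_mod_cast hsum
  have hprod' : (p : ℂ) * q = -μ := by exact_mod_cast hprod
  set v : ℝ → ℂ := fun s => α₁ s - q * α s with hv
  have hv' : ∀ s, HasDerivAt v (p * v s) s := by
    intro s
    have := (h2 s).sub ((h1 s).const_mul (q : ℂ))
    refine this.congr_deriv ?_
    simp only [hv]
    linear_combination (α s) * hprod' - (α₁ s) * hsum'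
  have hvs := eq_exp_of_hasDerivAt hv'
  -- `β = e^{-ds} α` is bounded
  set β : ℝ → ℂ := fun s => α s * Complex.exp (-(d * s)) with hβ
  have hβbd : ∀ s, ‖β s‖ ≤ K := by
    intro s
    rw [hβ, norm_mul, Complex.norm_exp]
    have h3 : (-((d : ℂ) * (s : ℂ))).re = -(d * s) := by simp
    rw [h3]
    calc _ ≤ K * Real.exp (d * s) * Real.exp (-(d * s)) :=
          mul_le_mul_of_nonneg_right (hK s) (Real.exp_nonneg _)
      _ = K := by rw [mul_assoc, ← Real.exp_add]; simp
  have hexp : ∀ s : ℝ, HasDerivAt (fun s : ℝ => Complex.exp (-(d * s)))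
      (-d * Complex.exp (-(d * s))) s := by
    intro s
    have h3 : HasDerivAt (fun t : ℝ => -((d : ℂ) * (t : ℂ))) (-((d : ℂ) * 1)) s :=
      ((hasDerivAt_id s).ofReal_comp.const_mul (d : ℂ)).neg
    refine h3.cexp.congr_deriv ?_
    ring
  have hβ' : ∀ s, HasDerivAt β (((q - d : ℝ) : ℂ) * β s +
      v 0 * Complex.exp (((p - d : ℝ) : ℂ) * s)) s := by
    intro s
    refine ((h1 s).mul (hexp s)).congr_deriv ?_
    have h4 : α₁ s = v 0 * Complex.exp (p * s) + q * α s := by rw [← hvs s]; simp [hv]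
    have h5 : Complex.exp (((p - d : ℝ) : ℂ) * s) =
        Complex.exp (p * s) * Complex.exp (-(d * s)) := by
      rw [← Complex.exp_add]; congr 1; push_cast; ring
    rw [h5, h4]
    simp only [hβ]
    push_cast
    ring
  have hv0 : v 0 = 0 :=
    eq_zero_of_bounded_of_hasDerivAt (by linarith) hβbd hβ'
  have hβexp := eq_exp_of_hasDerivAt (f := β) (c := ((q - d : ℝ) : ℂ)) fun s => by
    simpa [hv0] using hβ' s
  have hβ0 : β 0 = α 0 := by simp [hβ]
  have hα : ∀ s, α s = β s * Complex.exp (d * s) := by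
    intro s
    simp only [hβ]
    rw [mul_assoc, ← Complex.exp_add]
    simp
  have key : q - d ≠ 0 → α 0 = 0 := fun h => by
    rw [← hβ0]
    exact eq_zero_of_bounded_exp (fun s => by rw [← hβexp s]; exact hβbd s) h
  refine ⟨fun s => ?_, fun h => key fun h3 => h ?_⟩
  · rw [hα s, hβexp s, hβ0]
    by_cases h : q - d = 0
    · simp [h]
    · simp [key h]
  · have : d = q := by linarith
    rw [this]
    nlinarith

/-! ### Fourier coefficients of periodic functions -/

open MeasureTheory

/-- The linear map `t ↦ 2 π (m tⱼ - ∑ t)ⱼ`. It maps `ℤᵐ` into the lattice of the deck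
transformations of `hlParam`, so that a periodic function on `ℝᵐ` pulls back to a function on the
torus `(ℝ/ℤ)ᵐ`. -/
def torusMap (m : ℕ) : (Fin m → ℝ) →L[ℝ] Rn m :=
  LinearMap.toContinuousLinearMap
    { toFun := fun t => WithLp.toLp 2 fun j => 2 * Real.pi * (m * t j - ∑ i, t i)
      map_add' := fun s t => by
        ext j; simp only [Pi.add_apply, Finset.sum_add_distrib, PiLp.add_apply]; ring
      map_smul' := fun c t => by
        ext j
        simp only [Pi.smul_apply, smul_eq_mul, ← Finset.mul_sum, PiLp.smul_apply,
          RingHom.id_apply]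
        ring }

theorem torusMap_apply {m : ℕ} (t : Fin m → ℝ) (j : Fin m) :
    torusMap m t j = 2 * Real.pi * (m * t j - ∑ i, t i) := rfl

/-- Invariance under the lattice `2 π {n ∈ ℤᵐ : ∑ n = 0}` of deck transformations of `hlParam`. -/
def IsDeckPeriodic {m : ℕ} {β : Type*} (P : Rn m → β) : Prop :=
  ∀ (n : Fin m → ℤ), ∑ j, n j = 0 → ∀ x, P (x + WithLp.toLp 2 fun j => 2 * Real.pi * n j) = P x

/-- The character `t ↦ exp (2 π i ⟨k, t⟩)`. -/
def torusChar {m : ℕ} (k : Fin m → ℤ) (t : Fin m → ℝ) : ℂ :=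
  Complex.exp ((2 * Real.pi * ∑ i, k i * t i : ℝ) * Complex.I)

theorem torusChar_add {m : ℕ} (k : Fin m → ℤ) (s t : Fin m → ℝ) :
    torusChar k (s + t) = torusChar k s * torusChar k t := by
  rw [torusChar, torusChar, torusChar, ← Complex.exp_add]
  simp only [Pi.add_apply, mul_add, Finset.sum_add_distrib]
  push_cast
  ring_nf

theorem torusChar_neg {m : ℕ} (k : Fin m → ℤ) (t : Fin m → ℝ) :
    torusChar (-k) t = (torusChar k t)⁻¹ := by
  rw [torusChar, torusChar, ← Complex.exp_neg]
  simp only [Pi.neg_apply, Int.cast_neg, neg_mul, Finset.sum_neg_distrib, mul_neg,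
    Complex.ofReal_neg]

theorem torusChar_ne_zero {m : ℕ} (k : Fin m → ℤ) (t : Fin m → ℝ) : torusChar k t ≠ 0 :=
  Complex.exp_ne_zero _

theorem norm_torusChar {m : ℕ} (k : Fin m → ℤ) (t : Fin m → ℝ) : ‖torusChar k t‖ = 1 :=
  Complex.norm_exp_ofReal_mul_I _

theorem continuous_torusChar {m : ℕ} (k : Fin m → ℤ) : Continuous (torusChar k) := by
  unfold torusChar
  fun_prop

theorem mFourier_coe {m : ℕ} (k : Fin m → ℤ) (t : Fin m → ℝ) :
    UnitAddTorus.mFourier k (fun i => (t i : UnitAddCircle)) = torusChar k t := by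
  rw [UnitAddTorus.mFourier, ContinuousMap.coe_mk, torusChar]
  simp only [fourier_coe_apply]
  rw [← Complex.exp_sum]
  congr 1
  push_cast
  rw [Finset.mul_sum, Finset.sum_mul]
  refine Finset.sum_congr rfl fun i _ => ?_
  ring

/-- The unit cube, a fundamental domain of `ℤᵐ`, translated by `a`. -/
def cube {m : ℕ} (a : Fin m → ℝ) : Set (Fin m → ℝ) := {t | ∀ i, t i ∈ Set.Ioc (a i) (a i + 1)}

/-- The `k`-th Fourier coefficient of `t ↦ P (x + torusMap t)`. -/
def fCoeff {m : ℕ} (k : Fin m → ℤ) (P : Rn m → ℂ) (x : Rn m) : ℂ :=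
  ∫ t in cube 0, torusChar (-k) t * P (x + torusMap m t)

theorem cube_subset_Icc {m : ℕ} : cube (0 : Fin m → ℝ) ⊆ Set.Icc 0 1 := fun _ ht =>
  ⟨fun i => (ht i).1.le, fun i => by simpa using (ht i).2⟩

theorem measurableSet_cube {m : ℕ} (a : Fin m → ℝ) : MeasurableSet (cube a) :=
  MeasurableSet.univ_pi' fun _ => measurableSet_Ioc

theorem volume_cube_lt_top {m : ℕ} : volume (cube (0 : Fin m → ℝ)) < ⊤ :=
  (measure_mono cube_subset_Icc).trans_lt isCompact_Icc.measure_lt_top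

theorem integrableOn_cube {m : ℕ} {f : (Fin m → ℝ) → ℂ} (hf : Continuous f) :
    IntegrableOn f (cube 0) :=
  (hf.continuousOn.integrableOn_compact isCompact_Icc).mono_set cube_subset_Icc

theorem continuous_fCoeff_integrand {m : ℕ} (k : Fin m → ℤ) {P : Rn m → ℂ} (hP : Continuous P)
    (x : Rn m) : Continuous fun t => torusChar (-k) t * P (x + torusMap m t) :=
  (continuous_torusChar _).mul (hP.comp (continuous_const.add (torusMap m).continuous))

theorem IsDeckPeriodic.add_torusMap {m : ℕ} {β : Type*} {P : Rn m → β} (hP : IsDeckPeriodic P)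
    (n : Fin m → ℤ) (x : Rn m) : P (x + torusMap m fun i => n i) = P x := by
  have := hP (fun j => m * n j - ∑ i, n i) (by
    simp [Finset.sum_sub_distrib, ← Finset.mul_sum]) x
  rw [← this]
  congr 2
  ext j
  rw [torusMap_apply]
  push_cast
  rfl

/-- A periodic function descends to the torus. -/
theorem IsDeckPeriodic.exists_continuousMap {m : ℕ} {P : Rn m → ℂ} (hP : IsDeckPeriodic P)
    (hc : Continuous P) (x : Rn m) :
    ∃ g : C(UnitAddTorus (Fin m), ℂ), ∀ t : Fin m → ℝ,
      g (fun i => (t i : UnitAddCircle)) = P (x + torusMap m t) := by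
  have hq : IsOpenQuotientMap (Pi.map fun (_ : Fin m) (r : ℝ) => (r : UnitAddCircle)) :=
    .piMap fun _ => QuotientAddGroup.isOpenQuotientMap_mk
  let q : C(Fin m → ℝ, UnitAddTorus (Fin m)) := ⟨_, hq.continuous⟩
  have hq' : Topology.IsQuotientMap q := hq.isQuotientMap
  let f : C(Fin m → ℝ, ℂ) :=
    ⟨fun t => P (x + torusMap m t), hc.comp (continuous_const.add (torusMap m).continuous)⟩
  have hfac : Function.FactorsThrough f q := by
    intro s t hst
    have h1 : ∀ i, ∃ n : ℤ, (n : ℝ) = s i - t i := fun i => by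
      have h2 : ((s i - t i : ℝ) : UnitAddCircle) = 0 := by
        rw [AddCircle.coe_sub, sub_eq_zero]; exact congrFun hst i
      obtain ⟨n, hn⟩ := (AddCircle.coe_eq_zero_iff 1).1 h2
      exact ⟨n, by simpa using hn⟩
    choose n hn using h1
    have h3 : s = t + fun i => (n i : ℝ) := by ext i; simp [hn]
    change P (x + torusMap m s) = P (x + torusMap m t)
    rw [h3, map_add, ← add_assoc, hP.add_torusMap]
  exact ⟨hq'.lift f hfac, fun t => DFunLike.congr_fun (hq'.lift_comp f hfac) t⟩

/-- The integral over a translated cube does not depend on the translation, as it is a Fourier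
coefficient on the torus. -/
theorem integral_cube_eq_mFourierCoeff {m : ℕ} (k : Fin m → ℤ) {P : Rn m → ℂ} {x : Rn m}
    {g : C(UnitAddTorus (Fin m), ℂ)}
    (hg : ∀ t : Fin m → ℝ, g (fun i => (t i : UnitAddCircle)) = P (x + torusMap m t))
    (a : Fin m → ℝ) :
    ∫ t in cube a, torusChar (-k) t * P (x + torusMap m t) = UnitAddTorus.mFourierCoeff g k := by
  rw [UnitAddTorus.mFourierCoeff_eq_integral g k a]
  simp only [hg, mFourier_coe, smul_eq_mul]
  rfl

theorem fCoeff_add_torusMap {m : ℕ} (k : Fin m → ℤ) {P : Rn m → ℂ} (hP : IsDeckPeriodic P)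
    (hc : Continuous P) (x : Rn m) (τ : Fin m → ℝ) :
    fCoeff k P (x + torusMap m τ) = torusChar k τ * fCoeff k P x := by
  obtain ⟨g, hg⟩ := hP.exists_continuousMap hc x
  have h1 := (measurePreserving_add_right volume τ).setIntegral_preimage_emb
    (measurableEmbedding_addRight τ)
    (fun t => torusChar k τ * (torusChar (-k) t * P (x + torusMap m t))) (cube τ)
  have h2 : (fun t => t + τ) ⁻¹' cube τ = cube 0 := by
    ext t
    simp only [cube, Set.mem_preimage, Set.mem_ofPred_eq, Set.mem_Ioc, Pi.add_apply, Pi.zero_apply]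
    refine forall_congr' fun i => ?_
    constructor <;> rintro ⟨h3, h4⟩ <;> constructor <;> linarith
  rw [h2] at h1
  replace h1 := h1.trans (integral_const_mul _ _)
  rw [integral_cube_eq_mFourierCoeff k hg τ] at h1
  rw [fCoeff, fCoeff, integral_cube_eq_mFourierCoeff k hg 0, ← h1]
  congr 1
  ext t
  rw [torusChar_add, torusChar_neg, torusChar_neg, map_add, add_comm (torusMap m t), add_assoc]
  field_simp [torusChar_ne_zero]

/-- Fourier coefficients commute with directional derivatives. -/
theorem hasDerivAt_fCoeff {m : ℕ} (k : Fin m → ℤ) {P : Rn m → ℂ} (hP : ContDiff ℝ 1 P)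
    (x v : Rn m) (τ : ℝ) :
    HasDerivAt (fun τ : ℝ => fCoeff k P (x + τ • v))
      (fCoeff k (fun y => fderiv ℝ P y v) (x + τ • v)) τ := by
  have hc : Continuous fun y => fderiv ℝ P y v :=
    (hP.continuous_fderiv (by norm_num)).clm_apply continuous_const
  have hc2 : Continuous fun p : ℝ × (Fin m → ℝ) =>
      torusChar (-k) p.2 * fderiv ℝ P (x + p.1 • v + torusMap m p.2) v :=
    ((continuous_torusChar _).comp continuous_snd).mul (hc.comp (by fun_prop))
  obtain ⟨C, hC⟩ := ((isCompact_closedBall τ 1).prod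
    (isCompact_Icc (a := (0 : Fin m → ℝ)) (b := 1))).exists_bound_of_continuousOn hc2.continuousOn
  refine (hasDerivAt_integral_of_dominated_loc_of_deriv_le
    (F := fun (τ : ℝ) t => torusChar (-k) t * P (x + τ • v + torusMap m t))
    (F' := fun (τ : ℝ) t => torusChar (-k) t * fderiv ℝ P (x + τ • v + torusMap m t) v)
    (bound := fun _ => C) (Metric.ball_mem_nhds τ one_pos) ?_ ?_ ?_ ?_ ?_ ?_).2
  · exact Filter.Eventually.of_forall fun τ =>
      (continuous_fCoeff_integrand k hP.continuous _).aestronglyMeasurable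
  · exact integrableOn_cube (continuous_fCoeff_integrand k hP.continuous _)
  · exact (continuous_fCoeff_integrand k hc _).aestronglyMeasurable
  · refine ae_restrict_of_forall_mem (measurableSet_cube 0) fun t ht τ' hτ' => ?_
    exact hC (τ', t) ⟨Metric.ball_subset_closedBall hτ', cube_subset_Icc ht⟩
  · exact integrableOn_const volume_cube_lt_top.ne
  · refine Filter.Eventually.of_forall fun t τ' _ => ?_
    have h1 : HasDerivAt (fun τ : ℝ => x + τ • v + torusMap m t) v τ' := by
      simpa using (((hasDerivAt_id τ').smul_const v).const_add x).add_const (torusMap m t)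
    exact (((hP.differentiable (by norm_num)) _).hasFDerivAt.comp_hasDerivAt τ' h1).const_mul _

theorem fCoeff_add {m : ℕ} (k : Fin m → ℤ) {P Q : Rn m → ℂ} (hP : Continuous P)
    (hQ : Continuous Q) (x : Rn m) :
    fCoeff k (fun y => P y + Q y) x = fCoeff k P x + fCoeff k Q x := by
  simp only [fCoeff, mul_add]
  exact integral_add (integrableOn_cube (continuous_fCoeff_integrand k hP x))
    (integrableOn_cube (continuous_fCoeff_integrand k hQ x))

theorem fCoeff_const_mul {m : ℕ} (k : Fin m → ℤ) (P : Rn m → ℂ) (c : ℂ) (x : Rn m) :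
    fCoeff k (fun y => c * P y) x = c * fCoeff k P x := by
  simp only [fCoeff, mul_left_comm _ c]
  exact integral_const_mul _ _

theorem fCoeff_sum {m : ℕ} (k : Fin m → ℤ) {ι : Type*} (s : Finset ι) {P : ι → Rn m → ℂ}
    (hP : ∀ i, Continuous (P i)) (x : Rn m) :
    fCoeff k (fun y => ∑ i ∈ s, P i y) x = ∑ i ∈ s, fCoeff k (P i) x := by
  simp only [fCoeff, Finset.mul_sum]
  exact integral_finsetSum _ fun i _ =>
    integrableOn_cube (continuous_fCoeff_integrand k (hP i) x)

theorem norm_fCoeff_le {m : ℕ} (k : Fin m → ℤ) {P : Rn m → ℂ} {x : Rn m} {C : ℝ}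
    (hC : ∀ t, ‖P (x + torusMap m t)‖ ≤ C) : ‖fCoeff k P x‖ ≤ C := by
  have h1 := norm_setIntegral_le_of_norm_le_const (μ := volume) (s := cube (0 : Fin m → ℝ))
    (f := fun t => torusChar (-k) t * P (x + torusMap m t)) (C := C) volume_cube_lt_top
    fun t _ => by rw [norm_mul, norm_torusChar, one_mul]; exact hC t
  have h2 : volume.real (cube (0 : Fin m → ℝ)) = 1 := by
    have : cube (0 : Fin m → ℝ) = Set.univ.pi fun _ => Set.Ioc 0 1 := by
      ext t; simp [cube]
    rw [this, measureReal_def, Real.volume_pi_Ioc]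
    simp
  rwa [h2, mul_one] at h1

/-- Frequencies that occur are trivial on the kernel of `torusMap`, viewed as a homomorphism from
`(ℝ/ℤ)ᵐ` to `ℝᵐ` modulo deck transformations. The kernel contains the diagonal and the vectors
`(δᵢ - δⱼ) / m`. -/
theorem frequency_of_fCoeff_ne_zero {m : ℕ} (hm : 1 ≤ m) {k : Fin m → ℤ} {P : Rn m → ℂ}
    (hP : IsDeckPeriodic P) (hc : Continuous P) {x : Rn m} (h0 : fCoeff k P x ≠ 0) :
    ∑ i, k i = 0 ∧ ∀ i j, (m : ℤ) ∣ k i - k j := by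
  have hm0 : (m : ℝ) ≠ 0 := by exact_mod_cast (by lia : m ≠ 0)
  constructor
  · by_contra hk
    have hk' : (∑ i, (k i : ℝ)) ≠ 0 := by exact_mod_cast hk
    -- this shift multiplies the coefficient by `-1`
    have h1 := fCoeff_add_torusMap k hP hc x fun _ => 1 / (2 * ∑ i, (k i : ℝ))
    have h2 : torusMap m (fun _ => 1 / (2 * ∑ i, (k i : ℝ))) = 0 := by
      ext j
      rw [torusMap_apply]
      simp
    have h3 : torusChar k (fun _ => 1 / (2 * ∑ i, (k i : ℝ))) = -1 := by
      rw [torusChar, ← Finset.sum_mul, ← Complex.exp_pi_mul_I]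
      congr 3
      field_simp
    rw [h2, add_zero, h3] at h1
    exact h0 (by linear_combination (1 / 2 : ℂ) * h1)
  · intro i j
    set τ : Fin m → ℝ := fun l => ((if l = i then 1 else 0) - if l = j then 1 else 0) / m with hτ
    have h1 := fCoeff_add_torusMap k hP hc x τ
    have h2 : torusMap m τ = WithLp.toLp 2 fun l =>
        2 * Real.pi * (((if l = i then 1 else 0) - if l = j then 1 else 0 : ℤ) : ℝ) := by
      ext l
      rw [torusMap_apply, hτ, ← Finset.sum_div, Finset.sum_sub_distrib]
      simp only [Finset.sum_ite_eq', Finset.mem_univ, if_true, sub_self, zero_div, sub_zero]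
      push_cast
      field_simp
    have h3 : fCoeff k P (x + torusMap m τ) = fCoeff k P x := by
      simp only [fCoeff, add_right_comm x (torusMap m τ)]
      simp only [h2]
      have h4 := hP (fun l => (if l = i then 1 else 0) - if l = j then 1 else 0) (by
        simp [Finset.sum_sub_distrib])
      simp only [h4]
    rw [h3] at h1
    have h5 : torusChar k τ = 1 := mul_right_cancel₀ h0 (by rw [← h1, one_mul])
    obtain ⟨N, hN⟩ := Complex.exp_eq_one_iff.1 h5
    have h6 : ∑ l, (k l : ℝ) * τ l = (k i - k j) / m := by
      simp only [hτ, mul_div_assoc', ← Finset.sum_div, mul_sub, Finset.sum_sub_distrib]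
      simp
    rw [h6] at hN
    have h7 : 2 * Real.pi * (((k i : ℝ) - k j) / m) = N * (2 * Real.pi) := by
      have h8 : ((2 * Real.pi * (((k i : ℝ) - k j) / m) : ℝ) : ℂ) =
          ((N * (2 * Real.pi) : ℝ) : ℂ) := by
        apply mul_right_cancel₀ Complex.I_ne_zero
        rw [hN]; push_cast; ring
      exact_mod_cast h8
    have h9 : ((k i : ℝ) - k j) = m * N := by
      have := Real.pi_pos.ne'
      field_simp at h7
      linarith
    exact ⟨N, by exact_mod_cast h9⟩

/-- The vector `(1, …, 1)`. -/
def ones (m : ℕ) : Rn m := WithLp.toLp 2 fun _ => 1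

theorem mean_ones {m : ℕ} (hm : 1 ≤ m) : mean m (ones m) = 1 := by
  have hm0 : (m : ℝ) ≠ 0 := by exact_mod_cast (by lia : m ≠ 0)
  rw [mean_apply]
  simp [ones, hm0]

theorem mean_torusMap {m : ℕ} (t : Fin m → ℝ) : mean m (torusMap m t) = 0 := by
  rw [mean_apply]
  simp only [torusMap_apply, ← Finset.mul_sum, Finset.sum_sub_distrib]
  simp

theorem eq_mean_smul_ones_add {m : ℕ} (hm : 1 ≤ m) (x : Rn m) :
    x = mean m x • ones m + torusMap m fun j => x j / (2 * Real.pi * m) := by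
  have hm0 : (m : ℝ) ≠ 0 := by exact_mod_cast (by lia : m ≠ 0)
  have := Real.pi_pos.ne'
  ext j
  rw [PiLp.add_apply, torusMap_apply, PiLp.smul_apply, ← Finset.sum_div, mean_apply]
  simp only [ones, smul_eq_mul, mul_one]
  field_simp
  ring

theorem contDiff_partialD {m : ℕ} {n : WithTop ℕ∞} {P : Rn m → ℂ} (hP : ContDiff ℝ (n + 1) P)
    (i : Fin m) : ContDiff ℝ n (partialD i P) :=
  (hP.fderiv_right le_rfl).clm_apply contDiff_const

theorem partialD_ofReal {m : ℕ} {F : Rn m → ℝ} (hF : Differentiable ℝ F) (i : Fin m) :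
    partialD i (fun x => (F x : ℂ)) = fun x => ((partialD i F x : ℝ) : ℂ) := by
  ext x
  have h := Complex.ofRealCLM.hasFDerivAt.comp x (hF x).hasFDerivAt
  have h' : HasFDerivAt (fun x => (F x : ℂ)) _ x := h
  rw [partialD, h'.fderiv]
  rfl

/-- The ordinary differential equation for the Fourier coefficients of a solution of the equation of
`IsHarmonicOn.comp_hlParam`. -/
theorem fCoeff_ode {m : ℕ} (hm : 1 ≤ m) {P : Rn m → ℂ} (hP : ContDiff ℝ 2 P)
    (hper : IsDeckPeriodic P)
    (hpde : ∀ x, ∑ i, partialD i (partialD i P) x + (m - 2) / m * ∑ i, partialD i P x = 0)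
    {k : Fin m → ℤ} (hk : ∑ i, k i = 0) :
    ∃ α₁ : ℝ → ℂ, (∀ s : ℝ, HasDerivAt (fun s : ℝ => fCoeff k P (s • ones m)) (α₁ s) s) ∧
      ∀ s : ℝ, HasDerivAt α₁ ((((∑ i, (k i : ℝ) ^ 2) / m : ℝ) : ℂ) * fCoeff k P (s • ones m) -
        ((m - 2 : ℝ) : ℂ) * α₁ s) s := by
  have hm0 : (m : ℂ) ≠ 0 := by exact_mod_cast (by lia : m ≠ 0)
  have hm0' : (m : ℝ) ≠ 0 := by exact_mod_cast (by lia : m ≠ 0)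
  have hP1 : ContDiff ℝ 1 P := hP.of_le (by norm_num)
  set D : Rn m → ℂ := fun y => fderiv ℝ P y (ones m) with hD
  have hD1 : ContDiff ℝ 1 D := (hP.fderiv_right (m := 1) (by norm_num)).clm_apply contDiff_const
  set α : ℝ → ℂ := fun s => fCoeff k P (s • ones m) with hα
  set α₁ : ℝ → ℂ := fun s => fCoeff k D (s • ones m) with hα₁
  set α₂ : ℝ → ℂ := fun s => fCoeff k (fun y => fderiv ℝ D y (ones m)) (s • ones m) with hα₂
  have h1 : ∀ s, HasDerivAt α (α₁ s) s := fun s => by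
    simpa using hasDerivAt_fCoeff k hP1 0 (ones m) s
  have h2 : ∀ s, HasDerivAt α₁ (α₂ s) s := fun s => by
    simpa using hasDerivAt_fCoeff k hD1 0 (ones m) s
  have hcP : Continuous P := hP.continuous
  have hPi : ∀ i, ContDiff ℝ 1 (partialD i P) := fun i =>
    contDiff_partialD (n := 1) (hP.of_le (by norm_num)) i
  -- along the `i`-th coordinate direction, the coefficient is an explicit function of `α`
  have h3 : ∀ (s : ℝ) (i : Fin m) (τ : ℝ), fCoeff k P (s • ones m + τ • EuclideanSpace.single i 1) =
      Complex.exp ((Complex.I * k i / m) * τ) * α (s + τ / m) := by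
    intro s i τ
    have h4 := eq_mean_smul_ones_add hm (s • ones m + τ • EuclideanSpace.single i (1 : ℝ))
    rw [h4, fCoeff_add_torusMap k hper hcP]
    have h5 : mean m (s • ones m + τ • EuclideanSpace.single i 1) = s + τ / m := by
      rw [map_add, map_smul, map_smul, mean_single, mean_ones hm]
      simp [div_eq_mul_inv]
    rw [h5, torusChar]
    congr 2
    have h6 : ∑ j, (k j : ℝ) * ((s • ones m + τ • EuclideanSpace.single i (1 : ℝ)) j /
        (2 * Real.pi * m)) = k i * τ / (2 * Real.pi * m) := by
      have hk' : ∑ i, (k i : ℝ) = 0 := by exact_mod_cast hk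
      simp only [← mul_div_assoc, ← Finset.sum_div, PiLp.add_apply, PiLp.smul_apply, ones,
        smul_eq_mul, mul_one, mul_add, Finset.sum_add_distrib, ← Finset.sum_mul, hk']
      simp
    rw [h6]
    have hpi : (Real.pi : ℂ) ≠ 0 := by exact_mod_cast Real.pi_pos.ne'
    push_cast
    field_simp
  have hE : ∀ (c : ℂ) (τ : ℝ), HasDerivAt (fun τ : ℝ => Complex.exp (c * τ))
      (c * Complex.exp (c * τ)) τ := fun c τ => by
    refine ((hasDerivAt_id τ).ofReal_comp.const_mul c).cexp.congr_deriv ?_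
    simp; ring
  have hshift : ∀ {f f' : ℝ → ℂ}, (∀ s, HasDerivAt f (f' s) s) → ∀ s τ : ℝ,
      HasDerivAt (fun τ : ℝ => f (s + τ / m)) ((m : ℂ)⁻¹ * f' (s + τ / m)) τ := by
    intro f f' hf s τ
    have h4 : HasDerivAt (fun τ : ℝ => s + τ / m) ((m : ℝ)⁻¹) τ := by
      simpa using ((hasDerivAt_id τ).div_const (m : ℝ)).const_add s
    refine ((hf _).scomp τ h4).congr_deriv ?_
    rw [Complex.real_smul]
    push_cast
    rfl
  have h4 : ∀ (s : ℝ) (i : Fin m) (τ : ℝ),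
      fCoeff k (partialD i P) (s • ones m + τ • EuclideanSpace.single i 1) =
      Complex.exp ((Complex.I * k i / m) * τ) *
        (Complex.I * k i / m * α (s + τ / m) + (m : ℂ)⁻¹ * α₁ (s + τ / m)) := by
    intro s i τ
    refine (hasDerivAt_fCoeff k hP1 (s • ones m) (EuclideanSpace.single i 1) τ).unique ?_
    simp only [h3 s i]
    refine ((hE _ τ).mul (hshift h1 s τ)).congr_deriv ?_
    ring
  have h5 : ∀ (s : ℝ) (i : Fin m), fCoeff k (partialD i (partialD i P)) (s • ones m) =
      (Complex.I * k i / m) ^ 2 * α s + 2 * (Complex.I * k i / m) * (m : ℂ)⁻¹ * α₁ s +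
        (m : ℂ)⁻¹ ^ 2 * α₂ s := by
    intro s i
    have h6 := hasDerivAt_fCoeff k (hPi i) (s • ones m) (EuclideanSpace.single i 1) 0
    simp only [h4 s i] at h6
    have h7 := h6.unique ((hE _ 0).mul
      (((hshift h1 s 0).const_mul _).add ((hshift h2 s 0).const_mul _)))
    simp only [zero_smul, add_zero, Complex.ofReal_zero, mul_zero, Complex.exp_zero, zero_div,
      mul_one, one_mul] at h7
    refine Eq.trans ?_ (h7.trans ?_)
    · rfl
    · ring
  have h6 : ∀ (s : ℝ) (i : Fin m), fCoeff k (partialD i P) (s • ones m) =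
      Complex.I * k i / m * α s + (m : ℂ)⁻¹ * α₁ s := fun s i => by
    simpa using h4 s i 0
  refine ⟨α₁, h1, fun s => (h2 s).congr_deriv ?_⟩
  -- the coefficient of the equation itself, evaluated with the formulas for the derivatives
  have h7 : ∑ i, fCoeff k (partialD i (partialD i P)) (s • ones m) +
      (m - 2) / m * ∑ i, fCoeff k (partialD i P) (s • ones m) = 0 := by
    have hc1 : ∀ i, Continuous (partialD i P) := fun i => (hPi i).continuous
    have hc2 : ∀ i, Continuous (partialD i (partialD i P)) := fun i =>
      (contDiff_partialD (n := 0) ((hPi i).of_le (by norm_num)) i).continuous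
    have hc3 : Continuous fun y => ∑ i, partialD i (partialD i P) y :=
      continuous_finsetSum _ fun i _ => hc2 i
    have hc4 : Continuous fun y => (m - 2 : ℂ) / m * ∑ i, partialD i P y :=
      continuous_const.mul (continuous_finsetSum _ fun i _ => hc1 i)
    rw [← fCoeff_sum k _ hc2, ← fCoeff_sum k _ hc1, ← fCoeff_const_mul, ← fCoeff_add k hc3 hc4]
    simp only [hpde]
    simp [fCoeff]
  have hk' : ∑ i, (k i : ℂ) = 0 := by exact_mod_cast hk
  have hA : ∑ i, (Complex.I * (k i : ℂ) / m) = 0 := by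
    rw [← Finset.sum_div, ← Finset.mul_sum, hk']; simp
  have hB : ∑ i, (Complex.I * (k i : ℂ) / m) ^ 2 = -((∑ i, (k i : ℂ) ^ 2) / (m : ℂ) ^ 2) := by
    simp only [div_pow, mul_pow, Complex.I_sq, ← Finset.sum_div, neg_one_mul,
      Finset.sum_neg_distrib, neg_div]
  have h8 : ∑ i, fCoeff k (partialD i (partialD i P)) (s • ones m) =
      -((∑ i, (k i : ℂ) ^ 2) / (m : ℂ) ^ 2) * α s + (m : ℂ)⁻¹ * α₂ s := by
    simp only [h5, Finset.sum_add_distrib, ← Finset.sum_mul, ← Finset.mul_sum, hA, hB,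
      Finset.sum_const, Finset.card_univ, Fintype.card_fin, nsmul_eq_mul]
    field_simp
    ring
  have h9 : ∑ i, fCoeff k (partialD i P) (s • ones m) = α₁ s := by
    simp only [h6, Finset.sum_add_distrib, ← Finset.sum_mul, hA]
    simp [hm0]
  rw [h8, h9] at h7
  push_cast
  change α₂ s = (∑ i, (k i : ℂ) ^ 2) / m * α s - (m - 2) * α₁ s
  field_simp at h7 ⊢
  linear_combination h7

/-! ### Harmonic functions of linear and quadratic growth -/

/-- A solution of growth `e^{ds}` has only finitely many Fourier modes, each of which is homogeneous
of degree `d`; in terms of `n`, the eigenvalue equation for the frequency is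
`∑ (nᵢ - nⱼ)² = 2 d (d + m - 2)`. -/
theorem exists_finite_expansion {m : ℕ} (hm : 1 ≤ m) {d : ℕ} (hd : 1 ≤ d) {F : Rn m → ℝ}
    (hF : ContDiff ℝ 2 F) (hper : IsDeckPeriodic F)
    (hpde : ∀ x, ∑ i, partialD i (partialD i F) x + (m - 2) / m * ∑ i, partialD i F x = 0)
    {K : ℝ} (hK : ∀ x, |F x| ≤ K * Real.exp (d * mean m x)) :
    ∃ (S : Finset (Fin m → ℤ)) (n : (Fin m → ℤ) → Fin m → ℤ) (c : (Fin m → ℤ) → ℂ),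
      (∀ k ∈ S, ∑ i, ∑ j, (n k i - n k j) ^ 2 = 2 * ((d : ℤ) * (d + m - 2))) ∧
      ∀ x, (F x : ℂ) = ∑ k ∈ S, c k * Complex.exp (d * mean m x +
        (∑ i, n k i * (x i - mean m x) : ℝ) * Complex.I) := by
  have hm0 : (m : ℝ) ≠ 0 := by exact_mod_cast (by lia : m ≠ 0)
  have : Nonempty (Fin m) := ⟨⟨0, hm⟩⟩
  set P : Rn m → ℂ := fun x => F x with hP
  have hPC : ContDiff ℝ 2 P := Complex.ofRealCLM.contDiff.comp hF
  have hPper : IsDeckPeriodic P := fun n hn x => congrArg Complex.ofReal (hper n hn x)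
  have hPpde : ∀ x, ∑ i, partialD i (partialD i P) x + (m - 2) / m * ∑ i, partialD i P x = 0 := by
    intro x
    have h1 : ∀ i, Differentiable ℝ (partialD i F) := fun i =>
      ((hF.fderiv_right (m := 1) (by norm_num)).clm_apply contDiff_const).differentiable
        (by norm_num)
    simp only [hP, partialD_ofReal (hF.differentiable (by norm_num)), partialD_ofReal (h1 _)]
    exact_mod_cast congrArg Complex.ofReal (hpde x)
  have hbound : ∀ (k : Fin m → ℤ) (s : ℝ),
      ‖fCoeff k P (s • ones m)‖ ≤ K * Real.exp (d * s) := by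
    intro k s
    refine norm_fCoeff_le k fun t => ?_
    have h1 := hK (s • ones m + torusMap m t)
    rw [map_add, map_smul, mean_ones hm, mean_torusMap, smul_eq_mul, mul_one, add_zero] at h1
    rwa [hP, Complex.norm_real, Real.norm_eq_abs]
  set c : (Fin m → ℤ) → ℂ := fun k => fCoeff k P ((0 : ℝ) • ones m) with hc
  have hmode : ∀ k : Fin m → ℤ, (∀ s : ℝ, fCoeff k P (s • ones m) = c k * Complex.exp (d * s)) ∧
      (c k ≠ 0 → ∑ i, k i = 0 ∧ (∀ i j, (m : ℤ) ∣ k i - k j) ∧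
        ∑ i, k i ^ 2 = m * ((d : ℤ) * (d + m - 2))) := by
    intro k
    by_cases hk : ∑ i, k i = 0
    · obtain ⟨α₁, h1, h2⟩ := fCoeff_ode hm hPC hPper hPpde hk
      have hd' : (1 : ℝ) ≤ d := by exact_mod_cast hd
      have hm' : (1 : ℝ) ≤ m := by exact_mod_cast hm
      obtain ⟨h3, h4⟩ := eq_exp_of_growth (d := d)
        (div_nonneg (Finset.sum_nonneg fun i _ => sq_nonneg (k i : ℝ)) (Nat.cast_nonneg m))
        (by linarith) h1 h2 (hbound k)
      refine ⟨fun s => by simpa only [Complex.ofReal_natCast] using h3 s, fun h0 => ⟨hk,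
        (frequency_of_fCoeff_ne_zero hm hPper hPC.continuous h0).2, ?_⟩⟩
      by_contra h5
      refine h0 (h4 fun h6 => h5 ?_)
      rw [eq_div_iff hm0] at h6
      have h7 : (∑ i, (k i : ℝ) ^ 2) = m * ((d : ℝ) * (d + m - 2)) := by rw [← h6]; ring
      exact_mod_cast h7
    · have h0 : ∀ s : ℝ, fCoeff k P (s • ones m) = 0 := fun s => by
        by_contra h1
        exact hk (frequency_of_fCoeff_ne_zero hm hPper hPC.continuous h1).1
      have hc0 : c k = 0 := h0 0
      exact ⟨fun s => by rw [h0, hc0, zero_mul], fun h => absurd hc0 h⟩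
  -- the frequencies lie on a sphere, so that there are finitely many
  set M : ℤ := m * ((d : ℤ) * (d + m - 2)) with hM
  have hfin : {k : Fin m → ℤ | c k ≠ 0}.Finite := by
    refine (Set.finite_Icc (fun _ : Fin m => -M) fun _ => M).subset fun k hk => ?_
    have h1 := ((hmode k).2 hk).2.2
    have h2 : ∀ i, k i ^ 2 ≤ M := fun i => by
      rw [← h1]
      exact Finset.single_le_sum (f := fun i => k i ^ 2) (fun i _ => sq_nonneg _)
        (Finset.mem_univ i)
    refine ⟨fun i => ?_, fun i => ?_⟩
    · change -M ≤ k i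
      linarith [h2 i, Int.le_self_sq (-k i), neg_sq (k i)]
    · exact (Int.le_self_sq (k i)).trans (h2 i)
  have hn : ∀ k : Fin m → ℤ, ∃ n : Fin m → ℤ, c k ≠ 0 → ∀ i, k i = m * n i - ∑ j, n j := by
    intro k
    by_cases h : c k = 0
    · exact ⟨0, fun h' => absurd h h'⟩
    · obtain ⟨h1, h2, -⟩ := (hmode k).2 h
      obtain ⟨n, hn⟩ := exists_eq_card_mul_sub_sum k h1 (by simpa using h2)
      exact ⟨n, fun _ => by simpa using hn⟩
  choose n hn using hn
  refine ⟨hfin.toFinset, n, c, fun k hk => ?_, fun x => ?_⟩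
  · have hk0 : c k ≠ 0 := by simpa using hk
    obtain ⟨h1, -, h3⟩ := (hmode k).2 hk0
    have h4 := sum_sq_eq_of_eq_card_mul_sub_sum k (n k) h1 (by simpa using hn k hk0)
    rw [h3, Fintype.card_fin, hM] at h4
    have hmz : (m : ℤ) ≠ 0 := by exact_mod_cast (by lia : m ≠ 0)
    exact mul_left_cancel₀ hmz (by rw [← h4]; ring)
  · set s := mean m x with hs
    obtain ⟨g, hg⟩ := hPper.exists_continuousMap hPC.continuous (s • ones m)
    have hgc : ∀ k, UnitAddTorus.mFourierCoeff g k = c k * Complex.exp (d * s) := fun k => by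
      rw [← (hmode k).1 s, ← integral_cube_eq_mFourierCoeff k hg 0]
      rfl
    have hzero : ∀ k ∉ hfin.toFinset, UnitAddTorus.mFourierCoeff g k = 0 := fun k hk => by
      rw [hgc, show c k = 0 by simpa using hk, zero_mul]
    have h1 := UnitAddTorus.hasSum_mFourier_series_apply_of_summable
      (summable_of_ne_finset_zero hzero) fun i => ((x i / (2 * Real.pi * m) : ℝ) : UnitAddCircle)
    have h2 := h1.unique (hasSum_sum_of_ne_finset_zero (s := hfin.toFinset) fun k hk => by
      rw [hzero k hk, zero_smul])
    rw [hg fun i => x i / (2 * Real.pi * m), ← eq_mean_smul_ones_add hm x] at h2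
    refine h2.trans (Finset.sum_congr rfl fun k hk => ?_)
    have hk0 : c k ≠ 0 := by simpa using hk
    rw [hgc, mFourier_coe k fun i => x i / (2 * Real.pi * m), smul_eq_mul, mul_assoc, torusChar,
      ← Complex.exp_add]
    congr 5
    have h3 : ∀ i, (k i : ℝ) = m * n k i - ∑ j, (n k j : ℝ) := fun i => by
      exact_mod_cast hn k hk0 i
    have h4 : ∑ i, x i = m * s := by rw [hs, mean_apply, mul_inv_cancel_left₀ hm0]
    simp only [← mul_div_assoc, ← Finset.sum_div, h3, sub_mul, mul_sub, Finset.sum_sub_distrib,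
      mul_assoc, ← Finset.mul_sum, ← Finset.sum_mul, h4]
    have := Real.pi_pos.ne'
    field_simp

theorem isDeckPeriodic_hlParam (m : ℕ) : IsDeckPeriodic (hlParam m) := by
  intro n hn x
  have hn' : ∑ j, (n j : ℝ) = 0 := by exact_mod_cast hn
  have h1 : mean m (WithLp.toLp 2 fun j => 2 * Real.pi * n j) = 0 := by
    rw [mean_apply]
    simp [← Finset.mul_sum, hn']
  ext j
  have h2 : Complex.exp (logCoord m j (WithLp.toLp 2 fun j => 2 * Real.pi * n j)) = 1 := by
    rw [logCoord_apply, h1, Complex.exp_eq_one_iff]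
    exact ⟨n j, by push_cast; ring⟩
  rw [hlParam_apply, hlParam_apply, map_add, Complex.exp_add, h2, mul_one]

/-- `exists_finite_expansion` for harmonic functions on the cone. -/
theorem IsHarmonicOn.exists_finite_expansion {m : ℕ} (hm : 1 ≤ m) {d : ℕ} (hd : 1 ≤ d)
    {u : Cn m → ℝ} (hu : IsHarmonicOn m (harveyLawsonCone m \ {0}) u)
    (hgr : HasGrowth (harveyLawsonCone m) d u) :
    ∃ (S : Finset (Fin m → ℤ)) (n : (Fin m → ℤ) → Fin m → ℤ) (c : (Fin m → ℤ) → ℂ),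
      (∀ k ∈ S, ∑ i, ∑ j, (n k i - n k j) ^ 2 = 2 * ((d : ℤ) * (d + m - 2))) ∧
      ∀ x, u (hlParam m x) = ∑ k ∈ S, (c k * Complex.exp (d * mean m x +
        (∑ i, n k i * (x i - mean m x) : ℝ) * Complex.I)).re := by
  obtain ⟨hF, hpde⟩ := hu.comp_hlParam hm
  obtain ⟨K, hK⟩ := hgr
  obtain ⟨S, n, c, h1, h2⟩ := HLRigid.exists_finite_expansion hm hd hF
    (fun n hn x => congrArg u (isDeckPeriodic_hlParam m n hn x)) hpde
    (K := K * Real.sqrt m ^ d) fun x => by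
      refine (hK _ (hlParam_mem hm x)).trans_eq ?_
      rw [norm_hlParam, mul_pow, ← Real.exp_nat_mul, mul_assoc]
  refine ⟨S, n, c, h1, fun x => ?_⟩
  rw [← Complex.re_sum, ← h2 x, Complex.ofReal_re]
  rfl

theorem exists_translationHamiltonian_eq_re {m : ℕ} (j : Fin m) (c : ℂ) :
    ∃ v : Cn m, ∀ z, translationHamiltonian v z = (c * z j).re := by
  refine ⟨EuclideanSpace.single j ((starRingEnd ℂ) (Complex.I * c)), fun z => ?_⟩
  rw [translationHamiltonian, omega, EuclideanSpace.inner_single_left, Complex.conj_conj]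
  simp
  ring

/-- For `i ≠ j`, the functions `Re (c zᵢ z̄ⱼ)` are the Hamiltonians of the root vectors of
`su(m)`. -/
theorem exists_rotationHamiltonian_eq_re {m : ℕ} {i j : Fin m} (hij : i ≠ j) (c : ℂ) :
    ∃ A ∈ su m, ∀ z, rotationHamiltonian A z = (c * (z i * (starRingEnd ℂ) (z j))).re := by
  set w := (starRingEnd ℂ) (Complex.I * c) with hw
  refine ⟨Matrix.single i j w - Matrix.single j i ((starRingEnd ℂ) w), ⟨?_, ?_⟩, fun z => ?_⟩
  · rw [Matrix.conjTranspose_sub, Matrix.conjTranspose_single, Matrix.conjTranspose_single]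
    simp
  · rw [Matrix.trace_sub, Matrix.trace_single_eq_of_ne _ _ _ hij,
      Matrix.trace_single_eq_of_ne _ _ _ hij.symm, sub_zero]
  · have h1 : Matrix.toEuclideanLin
        (Matrix.single i j w - Matrix.single j i ((starRingEnd ℂ) w)) z =
        EuclideanSpace.single i (w * z j) - EuclideanSpace.single j ((starRingEnd ℂ) w * z i) := by
      ext l
      simp [Matrix.toLpLin_apply, Matrix.single_mulVec, Function.update_apply]
    rw [rotationHamiltonian, omega, h1, inner_sub_left, EuclideanSpace.inner_single_left,
      EuclideanSpace.inner_single_left, map_mul, map_mul, hw]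
    simp
    ring

theorem translationHamiltonian_sum {m : ℕ} {ι : Type*} (s : Finset ι) (v : ι → Cn m) (z : Cn m) :
    translationHamiltonian (∑ k ∈ s, v k) z = ∑ k ∈ s, translationHamiltonian (v k) z := by
  simp only [translationHamiltonian, omega, sum_inner, Complex.im_sum]

theorem rotationHamiltonian_sum {m : ℕ} {ι : Type*} (s : Finset ι)
    (A : ι → Matrix (Fin m) (Fin m) ℂ) (z : Cn m) :
    rotationHamiltonian (∑ k ∈ s, A k) z = ∑ k ∈ s, rotationHamiltonian (A k) z := by
  simp only [rotationHamiltonian, omega, map_sum, LinearMap.sum_apply, sum_inner, Complex.im_sum,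
    Finset.mul_sum]

theorem sum_mem_su {m : ℕ} {ι : Type*} (s : Finset ι) {A : ι → Matrix (Fin m) (Fin m) ℂ}
    (h : ∀ k ∈ s, A k ∈ su m) : ∑ k ∈ s, A k ∈ su m := by
  refine ⟨?_, ?_⟩
  · rw [Matrix.conjTranspose_sum, ← Finset.sum_neg_distrib]
    exact Finset.sum_congr rfl fun k hk => (h k hk).1
  · rw [Matrix.trace_sum]
    exact Finset.sum_eq_zero fun k hk => (h k hk).2

theorem exp_logCoord_eq {m : ℕ} (x : Rn m) (j : Fin m) :
    Complex.exp (logCoord m j x) = (hlPhase m)⁻¹ * hlParam m x j := by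
  rw [hlParam_apply, inv_mul_cancel_left₀ (hlPhase_ne_zero m)]

theorem hlParam_mul_conj {m : ℕ} (x : Rn m) (i j : Fin m) :
    hlParam m x i * (starRingEnd ℂ) (hlParam m x j) =
      Complex.exp (2 * mean m x + ((x i - mean m x - (x j - mean m x) : ℝ) : ℂ) * Complex.I) := by
  have h1 : hlPhase m * (starRingEnd ℂ) (hlPhase m) = 1 := by
    rw [Complex.mul_conj, Complex.normSq_eq_norm_sq, norm_hlPhase]; simp
  have h2 : Complex.exp (logCoord m i x) * (starRingEnd ℂ) (Complex.exp (logCoord m j x)) =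
      Complex.exp (2 * mean m x + ((x i - mean m x - (x j - mean m x) : ℝ) : ℂ) * Complex.I) := by
    rw [← Complex.exp_conj, ← Complex.exp_add, logCoord_apply, logCoord_apply]
    congr 1
    simp only [map_add, map_mul, Complex.conj_ofReal, Complex.conj_I]
    push_cast
    ring
  rw [hlParam_apply, hlParam_apply, map_mul, ← h2]
  linear_combination (Complex.exp (logCoord m i x) *
    (starRingEnd ℂ) (Complex.exp (logCoord m j x))) * h1

theorem harveyLawsonCone_linear {m : ℕ} (hm : 1 ≤ m) {u : Cn m → ℝ}
    (hu : IsHarmonicOn m (harveyLawsonCone m \ {0}) u)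
    (hgr : HasGrowth (harveyLawsonCone m) 1 u) :
    ∃ v : Cn m, ∀ z ∈ harveyLawsonCone m \ {0}, u z = translationHamiltonian v z := by
  have : Nonempty (Fin m) := ⟨⟨0, hm⟩⟩
  obtain ⟨S, n, c, h1, h2⟩ := hu.exists_finite_expansion hm le_rfl hgr
  have key : ∀ k, ∃ v : Cn m, k ∈ S → ∀ x,
      (c k * Complex.exp ((1 : ℕ) * mean m x +
        (∑ i, n k i * (x i - mean m x) : ℝ) * Complex.I)).re =
      translationHamiltonian v (hlParam m x) := by
    intro k
    by_cases hk : k ∈ S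
    swap
    · exact ⟨0, fun h => absurd h hk⟩
    have h3 := h1 k hk
    obtain ⟨a, j, h4⟩ := exists_single_of_sum_sum_sub_sq (n k) (by
      rw [h3, Fintype.card_fin]; push_cast; ring)
    rcases h4 with h4 | h4
    · obtain ⟨v, hv⟩ := exists_translationHamiltonian_eq_re j (c k * (hlPhase m)⁻¹)
      refine ⟨v, fun _ x => ?_⟩
      have h5 : ∑ i, (n k i : ℝ) * (x i - mean m x) = x j - mean m x := by
        simp only [h4, Int.cast_add, add_mul, Finset.sum_add_distrib, ← Finset.mul_sum,
          sum_sub_mean hm]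
        simp
      rw [hv, mul_assoc, ← exp_logCoord_eq, h5, logCoord_apply]
      simp
    · obtain ⟨v, hv⟩ := exists_translationHamiltonian_eq_re j
        ((starRingEnd ℂ) (c k) * (hlPhase m)⁻¹)
      refine ⟨v, fun _ x => ?_⟩
      have h5 : ∑ i, (n k i : ℝ) * (x i - mean m x) = -(x j - mean m x) := by
        simp only [h4, Int.cast_sub, sub_mul, Finset.sum_sub_distrib, ← Finset.mul_sum,
          sum_sub_mean hm]
        simp
      rw [hv, mul_assoc, ← exp_logCoord_eq, h5, logCoord_apply, ← Complex.conj_re, map_mul,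
        ← Complex.exp_conj]
      simp only [Nat.cast_one, one_mul, map_add, map_mul, Complex.conj_ofReal, Complex.conj_I]
      push_cast
      ring_nf
  choose v hv using key
  refine ⟨∑ k ∈ S, v k, fun z hz => ?_⟩
  obtain ⟨x, rfl⟩ := exists_hlParam_eq hm hz
  rw [translationHamiltonian_sum, h2 x]
  exact Finset.sum_congr rfl fun k hk => hv k hk x

theorem harveyLawsonCone_quadratic {m : ℕ} (hm : 1 ≤ m) (hm8 : m ≠ 8) (hm9 : m ≠ 9)
    {u : Cn m → ℝ} (hu : IsHarmonicOn m (harveyLawsonCone m \ {0}) u)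
    (hgr : HasGrowth (harveyLawsonCone m) 2 u) :
    ∃ A ∈ su m, ∀ z ∈ harveyLawsonCone m \ {0}, u z = rotationHamiltonian A z := by
  have : Nonempty (Fin m) := ⟨⟨0, hm⟩⟩
  obtain ⟨S, n, c, h1, h2⟩ := hu.exists_finite_expansion hm one_le_two hgr
  have key : ∀ k, ∃ A : Matrix (Fin m) (Fin m) ℂ, k ∈ S → A ∈ su m ∧ ∀ x,
      (c k * Complex.exp ((2 : ℕ) * mean m x +
        (∑ i, n k i * (x i - mean m x) : ℝ) * Complex.I)).re =
      rotationHamiltonian A (hlParam m x) := by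
    intro k
    by_cases hk : k ∈ S
    swap
    · exact ⟨0, fun h => absurd h hk⟩
    have h3 := h1 k hk
    obtain ⟨a, i, j, hij, h4⟩ := exists_sub_single_of_sum_sum_sub_sq (by simpa using hm8)
      (by simpa using hm9) (n k) (by rw [h3, Fintype.card_fin]; push_cast; ring)
    obtain ⟨A, hA, hv⟩ := exists_rotationHamiltonian_eq_re hij (c k)
    refine ⟨A, fun _ => ⟨hA, fun x => ?_⟩⟩
    have h5 : ∑ l, (n k l : ℝ) * (x l - mean m x) = x i - mean m x - (x j - mean m x) := by
      simp only [h4, Int.cast_sub, Int.cast_add, sub_mul, add_mul, Finset.sum_sub_distrib,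
        Finset.sum_add_distrib, ← Finset.mul_sum, sum_sub_mean hm]
      simp
    rw [hv, hlParam_mul_conj, h5]
    simp
  choose A hA using key
  refine ⟨∑ k ∈ S, A k, sum_mem_su S fun k hk => (hA k hk).1, fun z hz => ?_⟩
  obtain ⟨x, rfl⟩ := exists_hlParam_eq hm hz
  rw [rotationHamiltonian_sum, h2 x]
  exact Finset.sum_congr rfl fun k hk => (hA k hk).2 x

end

end HLRigid

theorem mainTheorem4 (m : ℕ) (hm : 1 ≤ m) (hm8 : m ≠ 8) (hm9 : m ≠ 9) :
    HLRigid.IsRigid (HLRigid.harveyLawsonCone m) where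
  isSpecialLagrangianCone := HLRigid.isSpecialLagrangianCone_harveyLawsonCone hm
  linear _ hu hgr := HLRigid.harveyLawsonCone_linear hm hu hgr
  quadratic _ hu hgr := HLRigid.harveyLawsonCone_quadratic hm hm8 hm9 hu hgr
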